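/- Let $K=\mathbb R$ (put $k=1$) or $K=\mathbb C$ (put $k=2$). Let $\mathcal P_d(K)$ be the set of symmetric (resp. Hermitian) positive definite $d\times d$ matrices and $\mathcal S=\{x\in\mathcal P_d(K):\det x=1\}$, $d\ge 1$, on which $SL_d(K)$ acts by $g\cdot x=gxg^*$. Let $\pi(X)=\det(X)^{-1/d}X$, and $\bar\Sigma=\pi(\Sigma)$. For $\Sigma\in\mathcal P_d(K)$ let $\mathcal W(\Sigma,n)$ be the law of $\sum_{i=1}^n Y_iY_i^*$, where the $Y_i$ are i.i.d. centred Gaussian vectors in $K^d$ of covariance $\Sigma$ (circularly symmetric if $K=\mathbb C$), and let $P\mathcal W(\Sigma,n)$ be the law of $\pi(X)$ for $X\sim\mathcal W(\Sigma,n)$, $n\ge d$. There exist nonzero, locally finite, $SL_d(K)$-invariant Borel measures on $\mathcal S$; let $\nu$ be any of them. By the density of $P\mathcal W(\Sigma,n)$ we mean a continuous function $f:\mathcal S\to[0,\infty)$ with $P\mathcal W(\Sigma,n)(A)=\int_A f\,d\nu$ for all Borel $A\subset\mathcal S$. (i) For all $d\ge 1$ and $n\ge d$ there is a constant $c>0$,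 depending only on $K,d,n,\nu$, such that for every $\Sigma\in\mathcal P_d(K)$ the law $P\mathcal W(\Sigma,n)$ has exactly one density, namely $$f(x)=c\,\det(\Sigma)^{-kn/2}\,\operatorname{tr}(\Sigma^{-1}x)^{-dkn/2}\qquad(x\in\mathcal S).$$ (ii) Let $d=2$. There is a constant $a>0$ such that, for the normalized affine-invariant distance $d(x,y)=a\,\|\log(x^{-1/2}yx^{-1/2})\|$ (Frobenius norm), the following holds. For every integer $n>2$ there is a constant $c>0$, depending only on $K,n,\nu$ and not on $\Sigma$, such that for every $\Sigma\in\mathcal P_2(K)$ the density of $P\mathcal W(\Sigma,n)$ is $$f(x)=c\,\cosh\bigl(d(x,\bar\Sigma)\bigr)^{-kn}\qquad(x\in\mathcal S).$$ In particular the profile function $\cosh^{-kn}$ does not depend on $\Sigma$. -/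

import Mathlib

open MeasureTheory ProbabilityTheory
open scoped Matrix ComplexOrder

noncomputable section

namespace PWishart

/-- The cone of positive definite matrices: symmetric over `ℝ`, Hermitian over `ℂ`. -/
abbrev PDMat (d : ℕ) (K : Type*) [RCLike K] : Type _ :=
  {X : Matrix (Fin d) (Fin d) K // X.PosDef}

/-- Positive definite matrices up to positive scaling, represented by those of determinant one. -/
abbrev UnitPDMat (d : ℕ) (K : Type*) [RCLike K] : Type _ :=
  {X : Matrix (Fin d) (Fin d) K // X.PosDef ∧ X.det = 1}

section Basic

variable {d : ℕ} {K : Type*} [RCLike K]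

/-- The determinant of a positive definite matrix, as a real number. -/
def realDet (X : PDMat d K) : ℝ := RCLike.re X.1.det

theorem realDet_pos (X : PDMat d K) : 0 < realDet X :=
  (RCLike.pos_iff.1 X.2.det_pos).1

theorem ofReal_realDet (X : PDMat d K) : ((realDet X : ℝ) : K) = X.1.det :=
  (RCLike.conj_eq_iff_re.1 (RCLike.conj_eq_iff_im.2 (RCLike.pos_iff.1 X.2.det_pos).2))

/-- The projection `X ↦ det(X)^(-1/d) X` onto the matrices of determinant one. -/
def proj (X : PDMat d K) : UnitPDMat d K :=
  ⟨((realDet X ^ (-(1 / (d : ℝ))) : ℝ) : K) • X.1, by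
    have h0 := realDet_pos X
    have hc : 0 < realDet X ^ (-(1 / (d : ℝ))) := Real.rpow_pos_of_pos h0 _
    refine ⟨X.2.smul (RCLike.ofReal_pos.2 hc), ?_⟩
    rcases Nat.eq_zero_or_pos d with hd | hd
    · subst hd
      exact Matrix.det_isEmpty
    · have hd' : (d : ℝ) ≠ 0 := by exact_mod_cast hd.ne'
      rw [Matrix.det_smul, Fintype.card_fin, ← ofReal_realDet X, ← RCLike.ofReal_pow,
        ← RCLike.ofReal_mul, ← Real.rpow_natCast, ← Real.rpow_mul h0.le]
      have : -(1 / (d : ℝ)) * (d : ℝ) = -1 := by field_simp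
      rw [this, Real.rpow_neg_one, inv_mul_cancel₀ h0.ne', RCLike.ofReal_one]⟩

/-- The action `g · x = g x g*` of `SL_d(K)` on positive definite matrices of determinant one. -/
def slAct (g : Matrix.SpecialLinearGroup (Fin d) K) (x : UnitPDMat d K) : UnitPDMat d K :=
  ⟨g.1 * x.1 * g.1ᴴ, by
    constructor
    · refine x.2.1.mul_mul_conjTranspose_same (B := g.1) ?_
      exact Matrix.vecMul_injective_of_isUnit
        ((Matrix.isUnit_iff_isUnit_det _).2 (by rw [g.2]; exact isUnit_one))
    · rw [Matrix.det_mul, Matrix.det_mul, Matrix.det_conjTranspose, g.2, x.2.2]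
      simp⟩

/-- The Hilbert-Schmidt (Frobenius) norm. -/
def hsNorm (M : Matrix (Fin d) (Fin d) K) : ℝ :=
  Real.sqrt (∑ i, ∑ j, ‖M i j‖ ^ 2)

/-- The unnormalized affine-invariant distance `‖log (x^(-1/2) y x^(-1/2))‖`; the real powers and
the logarithm are those of the functional calculus of Hermitian matrices. -/
def aiDist (x y : UnitPDMat d K) : ℝ :=
  hsNorm (cfc Real.log
    (cfc (fun t : ℝ => t ^ (-(1 / 2) : ℝ)) x.1 * y.1 * cfc (fun t : ℝ => t ^ (-(1 / 2) : ℝ)) x.1))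

end Basic

section Measures

/-- The entrywise (product) measurable structure on matrices. -/
instance instMeasurableSpaceMat (d : ℕ) (K : Type*) [MeasurableSpace K] :
    MeasurableSpace (Matrix (Fin d) (Fin d) K) :=
  inferInstanceAs (MeasurableSpace (Fin d → Fin d → K))

/-- It is the Borel structure. -/
instance instBorelSpaceMat (d : ℕ) (K : Type*) [RCLike K] [MeasurableSpace K] [BorelSpace K] :
    BorelSpace (Matrix (Fin d) (Fin d) K) :=
  inferInstanceAs (BorelSpace (Fin d → Fin d → K))

variable (K : Type*) [RCLike K] [MeasurableSpace K]

/-- The centred Gaussian law on `K` with `E |z|^2 = 1`: the standard normal law for `K = ℝ`; for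
`K = ℂ`, the law with independent real and imaginary parts of variance `1/2`. -/
def scalarGaussian : Measure K :=
  (stdGaussian K).map (fun z => ((Real.sqrt (Module.finrank ℝ K))⁻¹ : ℝ) • z)

variable {K} {d : ℕ}

/-- The centred (for `K = ℂ`, circularly symmetric) Gaussian law on `K^d` with covariance `S`:
the law of `S^(1/2) z`, where `z` has i.i.d. standard entries. -/
def gaussianVec (S : PDMat d K) : Measure (Fin d → K) :=
  (Measure.pi (fun _ : Fin d => scalarGaussian K)).map (fun z => cfc Real.sqrt S.1 *ᵥ z)

/-- The Wishart law: the law of `∑ i, Y i (Y i)*` for i.i.d. Gaussian vectors `Y 1, …, Y n`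
of covariance `S`. -/
def wishart (S : PDMat d K) (n : ℕ) : Measure (Matrix (Fin d) (Fin d) K) :=
  (Measure.pi (fun _ : Fin n => gaussianVec S)).map
    (fun Y => ∑ i, Matrix.vecMulVec (Y i) (star (Y i)))

/-- The projective Wishart law: the law of `proj X` for `X` of Wishart law. (For `d ≤ n` the matrix
`X` is almost surely positive definite; the Wishart law is restricted to that set of matrices.) -/
def projWishart (S : PDMat d K) (n : ℕ) : Measure (UnitPDMat d K) :=
  ((wishart S n).comap (Subtype.val : PDMat d K → Matrix (Fin d) (Fin d) K)).map proj

/-- An invariant volume measure: a nonzero locally finite Borel measure on the matrices of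
determinant one that is invariant under the action of `SL_d(K)`. -/
structure IsInvariantVolume (ν : Measure (UnitPDMat d K)) : Prop where
  ne_zero : ν ≠ 0
  locallyFinite : IsLocallyFiniteMeasure ν
  invariant : ∀ g : Matrix.SpecialLinearGroup (Fin d) K, ν.map (slAct g) = ν

/-- `f` is a continuous density of `μ` with respect to `ν`. -/
structure IsContinuousDensity (μ ν : Measure (UnitPDMat d K)) (f : UnitPDMat d K → ℝ) :
    Prop where
  continuous : Continuous f
  nonneg : ∀ x, 0 ≤ f x
  measure_eq : ∀ A : Set (UnitPDMat d K), MeasurableSet A →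
    μ A = ∫⁻ x in A, ENNReal.ofReal (f x) ∂ν

end Measures

end PWishart

end

/-! Write `S^(1/2) = r g` with `r > 0` and `g` in `SL_d(K)`. A Wishart matrix of covariance `S` is
`S^(1/2) G S^(1/2)`, where `G` is the Gram matrix of a standard Gaussian configuration `Z`.
Projection forgets `r`, so the projective law is the translate by `g` of the standard one
(`projWishart_eq_map`). It remains to find the density of the standard law against one invariant
measure, and to know that invariant measures are unique up to a factor.

Replace the Gaussian weight `exp(-(k/2) tr G)` by `exp(-det(G)^(1/d))`. This weight and Lebesgue
measure are both invariant under `Z ↦ gZ`, so its image under projection is an invariant measure,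
`coneMeasure`. Both exponents are homogeneous of degree two in `N = dkn` real variables, so for
functions homogeneous of degree zero, changing weights costs the factor `ratio^(-N/2)`
(`lintegral_exp_neg_homogeneous`). The ratio is `k/2` times the trace of the projected matrix. Hence
the standard density is proportional to `tr(x)^(-dkn/2)`, and translating by `g` gives the stated
kernel (`exists_stdProj_eq`, `wishartKernel_eq`).

Uniqueness of the invariant measure is Weil's Fubini argument (`IsInvariantVolume.lintegral_mul`).
Haar measure on `SL_d(K)` is replaced by Lebesgue measure on the matrices with determinant near one,
whose scalar part the projection kills. The argument also shows that an invariant measure charges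
every nonempty open set, so continuous densities are unique.

For `d = 2`, `x^(-1/2) y x^(-1/2)` has eigenvalues `λ` and `1/λ`, so its trace is `2 cosh(log λ)`,
while its logarithm has norm `√2 |log λ|`. -/

namespace PWishart

/-! ### Projection to determinant one, the linear action, square roots -/

section Algebra

variable {d : ℕ} {K : Type*} [RCLike K]

open Classical in
/-- The projection to the matrices of determinant one, extended by the identity matrix to matrices
that are not positive definite. -/
noncomputable def projT (X : Matrix (Fin d) (Fin d) K) : UnitPDMat d K :=
  if h : X.PosDef then proj ⟨X, h⟩ else ⟨1, Matrix.PosDef.one, Matrix.det_one⟩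

/-- The base point of the space of positive definite matrices of determinant one. -/
def basePt : UnitPDMat d K := ⟨1, Matrix.PosDef.one, Matrix.det_one⟩

theorem projT_of_posDef {X : Matrix (Fin d) (Fin d) K} (h : X.PosDef) :
    projT X = proj ⟨X, h⟩ := dif_pos h

theorem coe_projT {X : Matrix (Fin d) (Fin d) K} (h : X.PosDef) :
    (projT X).1 = ((RCLike.re X.det ^ (-(1 / (d : ℝ))) : ℝ) : K) • X := by
  rw [projT_of_posDef h]; rfl

theorem posDef_real_smul_iff {X : Matrix (Fin d) (Fin d) K} {c : ℝ} (hc : 0 < c) :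
    ((c : K) • X).PosDef ↔ X.PosDef := by
  constructor
  · intro h
    have := h.smul (RCLike.ofReal_pos.2 (inv_pos.2 hc) : (0 : K) < ((c⁻¹ : ℝ) : K))
    rwa [smul_smul, ← RCLike.ofReal_mul, inv_mul_cancel₀ hc.ne', RCLike.ofReal_one,
      one_smul] at this
  · intro h
    exact h.smul (RCLike.ofReal_pos.2 hc)

theorem re_det_pos {X : Matrix (Fin d) (Fin d) K} (h : X.PosDef) : 0 < RCLike.re X.det :=
  realDet_pos ⟨X, h⟩

theorem ofReal_re_det {X : Matrix (Fin d) (Fin d) K} (h : X.PosDef) :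
    ((RCLike.re X.det : ℝ) : K) = X.det :=
  ofReal_realDet ⟨X, h⟩

theorem re_det_real_smul (X : Matrix (Fin d) (Fin d) K) (c : ℝ) :
    RCLike.re ((c : K) • X).det = c ^ d * RCLike.re X.det := by
  rw [Matrix.det_smul, Fintype.card_fin, ← RCLike.ofReal_pow, RCLike.re_ofReal_mul]

theorem projT_smul (hd : 0 < d) (X : Matrix (Fin d) (Fin d) K) {c : ℝ} (hc : 0 < c) :
    projT ((c : K) • X) = projT X := by
  by_cases h : X.PosDef
  · have h' := (posDef_real_smul_iff hc).2 h
    apply Subtype.ext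
    rw [coe_projT h', coe_projT h, re_det_real_smul, smul_smul, ← RCLike.ofReal_mul]
    congr 2
    have hdet := re_det_pos h
    have hd' : (d : ℝ) ≠ 0 := by exact_mod_cast hd.ne'
    rw [Real.mul_rpow (by positivity) hdet.le, ← Real.rpow_natCast, ← Real.rpow_mul hc.le]
    have : (d : ℝ) * -(1 / (d : ℝ)) = -1 := by field_simp
    rw [this, Real.rpow_neg_one]
    field_simp
  · have h' : ¬ ((c : K) • X).PosDef := fun h' => h ((posDef_real_smul_iff hc).1 h')
    rw [projT, projT, dif_neg h, dif_neg h']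

theorem projT_coe (x : UnitPDMat d K) : projT x.1 = x := by
  apply Subtype.ext
  rw [coe_projT x.2.1, x.2.2]
  simp

theorem posDef_conj_iff {M : Matrix (Fin d) (Fin d) K} (hM : IsUnit M.det)
    (X : Matrix (Fin d) (Fin d) K) : (M * X * Mᴴ).PosDef ↔ X.PosDef :=
  Matrix.IsUnit.posDef_star_right_conjugate_iff ((Matrix.isUnit_iff_isUnit_det _).2 hM)

theorem projT_slAct (hd : 0 < d) (g : Matrix.SpecialLinearGroup (Fin d) K)
    {X : Matrix (Fin d) (Fin d) K} (hX : X.PosDef) :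
    projT (g.1 * X * g.1ᴴ) = slAct g (projT X) := by
  have hdet := re_det_pos hX
  have hc : 0 < RCLike.re X.det ^ (-(1 / (d : ℝ))) := Real.rpow_pos_of_pos hdet _
  rw [← projT_smul hd _ hc, ← projT_coe (slAct g (projT X))]
  congr 1
  simp only [slAct, coe_projT hX, Matrix.mul_smul, Matrix.smul_mul]

theorem slAct_mul (g h : Matrix.SpecialLinearGroup (Fin d) K) (x : UnitPDMat d K) :
    slAct (g * h) x = slAct g (slAct h x) := by
  apply Subtype.ext
  simp [slAct, Matrix.mul_assoc, Matrix.conjTranspose_mul]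

theorem slAct_one (x : UnitPDMat d K) : slAct 1 x = x := by
  apply Subtype.ext
  simp [slAct]

/-- The action of a matrix on the matrices of determinant one, through projection. -/
noncomputable def act (M : Matrix (Fin d) (Fin d) K) (x : UnitPDMat d K) : UnitPDMat d K :=
  projT (M * x.1 * Mᴴ)

/-- The scalar contributes only the positive factor `‖r‖²`, which the projection removes. Thus an
open set of matrices can stand in for the group. -/
theorem act_smul (hd : 0 < d) {r : K} (hr : r ≠ 0) (g : Matrix.SpecialLinearGroup (Fin d) K)
    (x : UnitPDMat d K) : act (r • g.1) x = slAct g x := by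
  have h : (r • g.1) * x.1 * (r • g.1)ᴴ = ((‖r‖ ^ 2 : ℝ) : K) • (slAct g x).1 := by
    simp only [slAct, Matrix.conjTranspose_smul, Matrix.smul_mul, Matrix.mul_smul, smul_smul]
    congr 1
    rw [RCLike.star_def, RCLike.conj_mul]; push_cast; rfl
  have hr' : 0 < ‖r‖ ^ 2 := by positivity
  rw [act, h, projT_smul hd _ hr', projT_coe]

attribute [irreducible] act

/-- The adjugate plays the role of the inverse: up to a scalar it acts as `g⁻¹`, and it is
polynomial in `M`, hence measurable. -/
theorem exists_eq_smul {M : Matrix (Fin d) (Fin d) K} {r : K} (hr : r ≠ 0)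
    (h : M.det = r ^ d) : ∃ g : Matrix.SpecialLinearGroup (Fin d) K, M = r • g.1 ∧
      M.adjugate = r ^ (d - 1) • (g⁻¹).1 := by
  have hg : (r⁻¹ • M).det = 1 := by
    rw [Matrix.det_smul, Fintype.card_fin, h, inv_pow, inv_mul_cancel₀ (pow_ne_zero _ hr)]
  have hM : M = r • (r⁻¹ • M) := by rw [smul_smul, mul_inv_cancel₀ hr, one_smul]
  refine ⟨⟨r⁻¹ • M, hg⟩, hM, ?_⟩
  conv_lhs => rw [hM, Matrix.adjugate_smul, Fintype.card_fin]
  rfl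

/-- The positive definite square root of a positive definite matrix. -/
noncomputable abbrev sqrtM (S : PDMat d K) : Matrix (Fin d) (Fin d) K := cfc Real.sqrt S.1

theorem cfc_continuousOn (S : Matrix (Fin d) (Fin d) K) (f : ℝ → ℝ) :
    ContinuousOn f (spectrum ℝ S) :=
  (Matrix.finite_real_spectrum (A := S)).continuousOn f

theorem spectrum_pos {S : Matrix (Fin d) (Fin d) K} (hS : S.PosDef) {t : ℝ}
    (ht : t ∈ spectrum ℝ S) : 0 < t := by
  rw [hS.1.spectrum_real_eq_range_eigenvalues] at ht
  obtain ⟨i, rfl⟩ := ht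
  exact hS.eigenvalues_pos i

theorem sqrtM_mul_self (S : PDMat d K) : sqrtM S * sqrtM S = S.1 := by
  rw [sqrtM, ← cfc_mul _ _ _ (cfc_continuousOn _ _) (cfc_continuousOn _ _)]
  conv_rhs => rw [← cfc_id' ℝ S.1 S.2.1]
  exact cfc_congr fun t ht => Real.mul_self_sqrt (spectrum_pos S.2 ht).le

theorem cfc_posDef {S : Matrix (Fin d) (Fin d) K} (hS : S.PosDef) (f : ℝ → ℝ)
    (hf : ∀ t, 0 < t → 0 < f t) : (cfc f S).PosDef := by
  rw [hS.1.cfc_eq, Matrix.IsHermitian.cfc, Unitary.conjStarAlgAut_apply]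
  refine (Matrix.IsUnit.posDef_star_right_conjugate_iff ?_).2 ?_
  · exact (Unitary.toUnits hS.1.eigenvectorUnitary).isUnit
  · rw [Matrix.posDef_diagonal_iff]
    intro i
    exact RCLike.ofReal_pos.2 (hf _ (hS.eigenvalues_pos i))

theorem sqrtM_posDef (S : PDMat d K) : (sqrtM S).PosDef :=
  cfc_posDef S.2 _ fun _ => Real.sqrt_pos.2

theorem exists_sqrtM_eq_smul (hd : 0 < d) (S : PDMat d K) :
    ∃ (r : ℝ) (g : Matrix.SpecialLinearGroup (Fin d) K), 0 < r ∧ sqrtM S = (r : K) • g.1 := by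
  have hdet := re_det_pos (sqrtM_posDef S)
  have hr : 0 < RCLike.re (sqrtM S).det ^ (1 / (d : ℝ)) := Real.rpow_pos_of_pos hdet _
  have hd' : (d : ℝ) ≠ 0 := by exact_mod_cast hd.ne'
  obtain ⟨g, hg, -⟩ := exists_eq_smul (M := sqrtM S)
    (r := ((RCLike.re (sqrtM S).det ^ (1 / (d : ℝ)) : ℝ) : K))
    (by exact_mod_cast hr.ne') (by
      rw [← RCLike.ofReal_pow, ← Real.rpow_natCast, ← Real.rpow_mul hdet.le,
        one_div_mul_cancel hd', Real.rpow_one, ofReal_re_det (sqrtM_posDef S)])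
  exact ⟨_, g, hr, hg⟩

/-- Transitivity: `x` is the image of the identity under its own square root, normalized to
determinant one. -/
theorem exists_slAct_basePt (hd : 0 < d) (x : UnitPDMat d K) :
    ∃ h : Matrix.SpecialLinearGroup (Fin d) K, slAct h basePt = x := by
  obtain ⟨r, g, hr, hg⟩ := exists_sqrtM_eq_smul hd (⟨x.1, x.2.1⟩ : PDMat d K)
  refine ⟨g, ?_⟩
  rw [← act_smul hd (r := (r : K)) (by exact_mod_cast hr.ne'), ← hg, act, basePt, Matrix.mul_one,
    (sqrtM_posDef _).1.eq, sqrtM_mul_self, projT_coe]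

end Algebra

/-! ### Measurability of the positive definite cone and of the projection -/

section Measurability

variable {d : ℕ} {K : Type*} [RCLike K]

theorem isClosed_posSemidef : IsClosed {X : Matrix (Fin d) (Fin d) K | X.PosSemidef} := by
  simp only [Matrix.posSemidef_iff_dotProduct_mulVec, Matrix.IsHermitian, Set.ofPred_and,
    Set.ofPred_forall]
  refine IsClosed.inter (isClosed_eq (by fun_prop) (by fun_prop)) (isClosed_iInter fun x => ?_)
  have : Continuous fun X : Matrix (Fin d) (Fin d) K => star x ⬝ᵥ X *ᵥ x := by fun_prop
  exact isClosed_le continuous_const this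

theorem continuous_slAct (g : Matrix.SpecialLinearGroup (Fin d) K) : Continuous (slAct g) := by
  refine Continuous.subtype_mk ?_ _
  fun_prop

variable [MeasurableSpace K] [BorelSpace K]

theorem measurableSet_posDef : MeasurableSet {X : Matrix (Fin d) (Fin d) K | X.PosDef} := by
  have : {X : Matrix (Fin d) (Fin d) K | X.PosDef} = {X | X.PosSemidef} ∩ {X | X.det ≠ 0} := by
    ext X
    exact ⟨fun h => ⟨h.posSemidef, h.posSemidef.posDef_iff_det_ne_zero.1 h⟩,
      fun h => h.1.posDef_iff_det_ne_zero.2 h.2⟩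
  rw [this]
  refine isClosed_posSemidef.measurableSet.inter (IsOpen.measurableSet ?_)
  exact isOpen_ne_fun (Continuous.matrix_det continuous_id) continuous_const

theorem measurable_projT : Measurable (projT : Matrix (Fin d) (Fin d) K → UnitPDMat d K) := by
  classical
  have h : Measurable fun X : Matrix (Fin d) (Fin d) K => (projT X).1 := by
    have : (fun X : Matrix (Fin d) (Fin d) K => (projT X).1) = fun X => if X.PosDef then
        ((RCLike.re X.det ^ (-(1 / (d : ℝ))) : ℝ) : K) • X else 1 := by
      ext1 X
      split_ifs with h
      · exact coe_projT h
      · rw [projT, dif_neg h]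
    rw [this]
    refine Measurable.ite measurableSet_posDef ?_ measurable_const
    have h1 : Measurable fun X : Matrix (Fin d) (Fin d) K => RCLike.re X.det :=
      (RCLike.continuous_re.comp (Continuous.matrix_det continuous_id)).measurable
    have h2 : Measurable fun X : Matrix (Fin d) (Fin d) K =>
        ((RCLike.re X.det ^ (-(1 / (d : ℝ))) : ℝ) : K) :=
      RCLike.continuous_ofReal.measurable.comp (h1.pow_const _)
    exact h2.smul measurable_id
  exact h.subtype_mk

end Measurability

/-! ### Gaussian laws as exponentials of quadratic forms -/

section Density

theorem lintegral_fin_prod {α : Type*} [MeasurableSpace α] {n : ℕ}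
    (μ : Fin n → Measure α) [∀ i, SigmaFinite (μ i)] (f : Fin n → α → ENNReal)
    (hf : ∀ i, Measurable (f i)) :
    ∫⁻ x, ∏ i, f i (x i) ∂(Measure.pi μ) = ∏ i, ∫⁻ x, f i x ∂(μ i) := by
  induction n with
  | zero => simp
  | succ n ih =>
    rw [← ((measurePreserving_piFinSuccAbove μ 0).symm).lintegral_comp_emb
      (MeasurableEquiv.measurableEmbedding _)]
    simp only [MeasurableEquiv.piFinSuccAbove_symm_apply, Fin.insertNthEquiv,
            Fin.prod_univ_succ, Fin.insertNth_zero, Equiv.coe_fn_mk, Fin.cons_succ,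
            Fin.zero_succAbove, Fin.cons_zero, cast_eq]
    rw [lintegral_prod_mul (f := f 0) (g := fun y : Fin n → α => ∏ i, f i.succ (y i))
      (hf 0).aemeasurable
      (Finset.measurable_prod _ fun i _ => (hf _).comp (measurable_pi_apply i)).aemeasurable,
      ih _ _ fun i => hf _]

theorem pi_smul_withDensity {α : Type*} [MeasurableSpace α] {n : ℕ} (μ : Measure α)
    [SigmaFinite μ] (f : α → ENNReal) (hf : Measurable f) (c : ENNReal)
    [SigmaFinite (c • μ.withDensity f)] :
    Measure.pi (fun _ : Fin n => c • μ.withDensity f) =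
      c ^ n • (Measure.pi fun _ : Fin n => μ).withDensity (fun x => ∏ i, f (x i)) := by
  refine Measure.pi_eq fun s hs => ?_
  rw [Measure.smul_apply, withDensity_apply _ (.univ_pi hs), Measure.restrict_pi_pi,
    lintegral_fin_prod _ (fun _ => f) fun _ => hf]
  simp [withDensity_apply _ (hs _), Finset.prod_mul_distrib]

theorem map_smul_withDensity_comp {α β : Type*} [MeasurableSpace α] [MeasurableSpace β]
    (μ : Measure α) {φ : α → β} (hφ : Measurable φ) {f : β → ENNReal} (hf : Measurable f)
    (c : ENNReal) :
    (c • μ.withDensity (fun x => f (φ x))).map φ = c • (μ.map φ).withDensity f := by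
  ext s hs
  rw [Measure.map_apply hφ hs, Measure.smul_apply, Measure.smul_apply,
    withDensity_apply _ (hφ hs), withDensity_apply _ hs, setLIntegral_map hs hf hφ]

/-- The measure `μ` has density `C exp (-Q)` for some constant `C > 0`. -/
def HasExpDensity {α : Type*} [MeasureSpace α] (μ : Measure α) (Q : α → ℝ) : Prop :=
  ∃ C : ENNReal, C ≠ 0 ∧ C ≠ ⊤ ∧
    μ = C • (volume : Measure α).withDensity (fun x => ENNReal.ofReal (Real.exp (-Q x)))

theorem HasExpDensity.pi {α : Type*} [MeasureSpace α] [SigmaFinite (volume : Measure α)]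
    {μ : Measure α} [SigmaFinite μ] {Q : α → ℝ} (hQ : Measurable Q) (h : HasExpDensity μ Q)
    (n : ℕ) :
    HasExpDensity (Measure.pi fun _ : Fin n => μ) (fun x => ∑ i, Q (x i)) := by
  obtain ⟨C, h0, ht, rfl⟩ := h
  refine ⟨C ^ n, pow_ne_zero _ h0, ENNReal.pow_ne_top ht, ?_⟩
  have hm : Measurable fun x => ENNReal.ofReal (Real.exp (-Q x)) := by fun_prop
  rw [pi_smul_withDensity _ _ hm, volume_pi]
  congr 2
  ext x
  rw [← Finset.sum_neg_distrib, Real.exp_sum, ENNReal.ofReal_prod_of_nonneg]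
  intro i _
  positivity

theorem hasExpDensity_gaussianReal : HasExpDensity (gaussianReal 0 1) (fun x => x ^ 2 / 2) := by
  refine ⟨ENNReal.ofReal (√(2 * Real.pi))⁻¹, ?_, ENNReal.ofReal_ne_top, ?_⟩
  · rw [Ne, ENNReal.ofReal_eq_zero, not_le]
    positivity
  · rw [gaussianReal_of_var_ne_zero _ one_ne_zero, ← withDensity_smul _ (by fun_prop)]
    congr 1
    ext x
    rw [gaussianPDF, gaussianPDFReal, ENNReal.ofReal_mul (by positivity)]
    simp [neg_div]

variable (K : Type*) [RCLike K] [MeasurableSpace K] [BorelSpace K]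

/-- Coordinates in a real orthonormal basis of `K` treat `ℝ` and `ℂ` at once: the coordinate map
preserves both the volume and the quadratic form. -/
theorem hasExpDensity_stdGaussian : HasExpDensity (stdGaussian K) (fun z => ‖z‖ ^ 2 / 2) := by
  obtain ⟨C, h0, ht, h⟩ := hasExpDensity_gaussianReal.pi (by fun_prop) (Module.finrank ℝ K)
  refine ⟨C, h0, ht, ?_⟩
  set b := stdOrthonormalBasis ℝ K
  have hφ : MeasurePreserving
      (fun x : Fin (Module.finrank ℝ K) → ℝ => ∑ i, x i • b i) := by
    have := b.measurePreserving_repr_symm.comp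
      (PiLp.volume_preserving_toLp (Fin (Module.finrank ℝ K)))
    have e : (fun x : Fin (Module.finrank ℝ K) → ℝ => ∑ i, x i • b i) =
        b.repr.symm ∘ WithLp.toLp 2 := by
      funext x
      simpa using b.sum_repr_symm (WithLp.toLp 2 x)
    rw [e]
    exact this
  have hn : ∀ x : Fin (Module.finrank ℝ K) → ℝ, ‖∑ i, x i • b i‖ ^ 2 = ∑ i, x i ^ 2 := by
    intro x
    rw [← OrthonormalBasis.sum_sq_norm_inner_right b]
    refine Finset.sum_congr rfl fun i _ => ?_
    rw [b.orthonormal.inner_right_fintype]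
    simp
  rw [stdGaussian, h]
  have := map_smul_withDensity_comp (volume : Measure (Fin (Module.finrank ℝ K) → ℝ))
    hφ.measurable (f := fun z : K => ENNReal.ofReal (Real.exp (-(‖z‖ ^ 2 / 2)))) (by fun_prop) C
  rw [hφ.map_eq] at this
  rw [← this]
  simp only [hn, Finset.sum_div]
  rfl

theorem hasExpDensity_scalarGaussian :
    HasExpDensity (scalarGaussian K) (fun z => (Module.finrank ℝ K : ℝ) / 2 * ‖z‖ ^ 2) := by
  obtain ⟨C, h0, ht, h⟩ := hasExpDensity_stdGaussian K
  have hk : (0 : ℝ) < Module.finrank ℝ K := by exact_mod_cast Module.finrank_pos (R := ℝ) (M := K)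
  set c : ℝ := (√(Module.finrank ℝ K : ℝ))⁻¹ with hc
  have hc0 : c ≠ 0 := by positivity
  set s := ENNReal.ofReal |(c ^ Module.finrank ℝ K)⁻¹|
  have hs0 : s ≠ 0 := by
    rw [Ne, ENNReal.ofReal_eq_zero, not_le]; positivity
  refine ⟨C * s, mul_ne_zero h0 hs0, ENNReal.mul_ne_top ht ENNReal.ofReal_ne_top, ?_⟩
  have := map_smul_withDensity_comp (volume : Measure K)
    (φ := fun z : K => c • z) (by fun_prop)
    (f := fun z : K => ENNReal.ofReal (Real.exp (-((Module.finrank ℝ K : ℝ) / 2 * ‖z‖ ^ 2))))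
    (by fun_prop) C
  rw [Measure.map_addHaar_smul (volume : Measure K) hc0, withDensity_smul_measure, smul_smul] at this
  rw [scalarGaussian, h, ← this]
  congr 3
  ext z
  congr 3
  rw [norm_smul, mul_pow, Real.norm_eq_abs, sq_abs, hc, inv_pow, Real.sq_sqrt hk.le]
  field_simp

instance : IsProbabilityMeasure (scalarGaussian K) :=
  Measure.isProbabilityMeasure_map (by fun_prop)

theorem hasExpDensity_pi_scalarGaussian (n d : ℕ) :
    HasExpDensity (Measure.pi fun _ : Fin n => Measure.pi fun _ : Fin d => scalarGaussian K)
      (fun Z => (Module.finrank ℝ K : ℝ) / 2 * ∑ i, ∑ j, ‖Z i j‖ ^ 2) := by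
  have := ((hasExpDensity_scalarGaussian K).pi (by fun_prop) d).pi (by fun_prop) n
  simpa only [Finset.mul_sum] using this

end Density

/-! ### Exchanging homogeneous exponential weights -/

section Homogeneous

theorem lintegral_exp_sub_exp_ne_zero (N : ℝ) :
    ∫⁻ τ : ℝ, ENNReal.ofReal (Real.exp (N * τ - Real.exp (2 * τ))) ≠ 0 := by
  rw [Ne, lintegral_eq_zero_iff (by fun_prop)]
  intro h
  have := h.exists
  obtain ⟨τ, hτ⟩ := this
  simp only [Pi.zero_apply, ENNReal.ofReal_eq_zero] at hτ
  exact absurd hτ (not_le.2 (Real.exp_pos _))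

/-- In the variable `t = exp(2τ)` this is the Gamma integral `Γ(N/2)/2`. Only its finiteness and
nonvanishing are used, as it cancels later. -/
theorem lintegral_exp_sub_exp_ne_top {N : ℝ} (hN : 0 < N) :
    ∫⁻ τ : ℝ, ENNReal.ofReal (Real.exp (N * τ - Real.exp (2 * τ))) ≠ ⊤ := by
  have hb : ∀ τ : ℝ, N * τ - Real.exp (2 * τ) ≤ |N * (1 - Real.log N)| - N * |τ| := by
    intro τ
    rcases le_total τ 0 with h | h
    · rw [abs_of_nonpos h]
      have := Real.exp_pos (2 * τ)
      have := abs_nonneg (N * (1 - Real.log N))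
      linarith
    · rw [abs_of_nonneg h]
      -- The tangent of `exp` at `log N` has slope `N`, so it beats `Nτ` by another `Nτ`.
      have h1 : Real.exp (2 * τ) = N * Real.exp (2 * τ - Real.log N) := by
        rw [Real.exp_sub, Real.exp_log hN]; field_simp
      have h2 := mul_le_mul_of_nonneg_left (Real.add_one_le_exp (2 * τ - Real.log N)) hN.le
      have h3 := neg_abs_le (N * (1 - Real.log N))
      rw [h1]
      linarith
  have hle : ∀ τ : ℝ, Real.exp (N * τ - Real.exp (2 * τ)) ≤
      Real.exp |N * (1 - Real.log N)| * Real.exp (-N * |τ|) := by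
    intro τ
    rw [← Real.exp_add]
    exact Real.exp_le_exp.2 ((hb τ).trans_eq (by ring))
  have hint : Integrable fun τ : ℝ => Real.exp (-N * |τ|) := by
    rw [← integrableOn_univ, ← Set.Iic_union_Ioi (a := (0 : ℝ))]
    refine IntegrableOn.union ?_ ?_
    · refine (integrableOn_exp_mul_Iic hN 0).congr_fun (fun τ hτ => ?_) measurableSet_Iic
      simp only [abs_of_nonpos (Set.mem_Iic.1 hτ)]
      congr 1; ring
    · refine (exp_neg_integrableOn_Ioi 0 hN).congr_fun (fun τ hτ => ?_) measurableSet_Ioi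
      simp only [abs_of_pos (Set.mem_Ioi.1 hτ)]
  refine ((lintegral_mono fun τ => ENNReal.ofReal_le_ofReal (hle τ)).trans_lt ?_).ne
  exact (hint.const_mul _).lintegral_lt_top

theorem lintegral_exp_sub_mul_exp (N : ℝ) {a : ℝ} (ha : 0 < a) :
    ∫⁻ τ : ℝ, ENNReal.ofReal (Real.exp (N * τ - a * Real.exp (2 * τ))) =
      ENNReal.ofReal (a ^ (-(N / 2))) *
        ∫⁻ τ : ℝ, ENNReal.ofReal (Real.exp (N * τ - Real.exp (2 * τ))) := by
  rw [← lintegral_const_mul' _ _ ENNReal.ofReal_ne_top,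
    ← lintegral_add_right_eq_self _ (-(Real.log a / 2))]
  congr 1
  ext τ
  rw [← ENNReal.ofReal_mul (by positivity), Real.rpow_def_of_pos ha, ← Real.exp_add]
  have : Real.exp (2 * (τ + -(Real.log a / 2))) = Real.exp (2 * τ) / a := by
    rw [show 2 * (τ + -(Real.log a / 2)) = 2 * τ - Real.log a by ring, Real.exp_sub,
      Real.exp_log ha]
  rw [this]
  congr 2
  field_simp
  ring

theorem lintegral_exp_neg_sub_mul_exp_neg (N : ℝ) {a : ℝ} (ha : 0 < a) :
    ∫⁻ τ : ℝ, ENNReal.ofReal (Real.exp (-(N * τ) - a * Real.exp (-(2 * τ)))) =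
      ENNReal.ofReal (a ^ (-(N / 2))) *
        ∫⁻ τ : ℝ, ENNReal.ofReal (Real.exp (N * τ - Real.exp (2 * τ))) := by
  rw [← lintegral_exp_sub_mul_exp N ha, ← lintegral_neg_eq_self]
  congr 1
  ext τ
  congr 3
  · ring
  · ring_nf

variable {E : Type*} [NormedAddCommGroup E] [NormedSpace ℝ E] [FiniteDimensional ℝ E]
  [MeasurableSpace E] [BorelSpace E]

theorem lintegral_eq_lintegral_smul (μ : Measure E) [μ.IsAddHaarMeasure] {s : ℝ} (hs : 0 < s)
    {G : E → ENNReal} (hG : Measurable G) :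
    ∫⁻ z, G z ∂μ = ENNReal.ofReal (s ^ Module.finrank ℝ E) * ∫⁻ z, G (s • z) ∂μ := by
  have h := lintegral_map hG (measurable_const_smul (α := E) s) (μ := μ)
  rw [Measure.map_addHaar_smul μ hs.ne', lintegral_smul_measure] at h
  have hp : 0 < s ^ Module.finrank ℝ E := by positivity
  rw [← h, smul_eq_mul, ← mul_assoc, ← ENNReal.ofReal_mul hp.le, abs_of_pos (inv_pos.2 hp),
    mul_inv_cancel₀ hp.ne', ENNReal.ofReal_one, one_mul]

/-- Comparison of two exponential weights on a cone: the integrals of a function homogeneous of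
degree zero against `exp (-u)` and `exp (-v)`, with `u` and `v` homogeneous of degree two. -/
theorem lintegral_exp_neg_homogeneous (μ : Measure E) [μ.IsAddHaarMeasure]
    (hN : 0 < Module.finrank ℝ E) {F : E → ENNReal} (hF : Measurable F)
    (hF' : ∀ s : ℝ, 0 < s → ∀ z, F (s • z) = F z) {u v : E → ℝ} (hu : Measurable u)
    (hv : Measurable v) (hu' : ∀ s : ℝ, 0 < s → ∀ z, u (s • z) = s ^ 2 * u z)
    (hv' : ∀ s : ℝ, 0 < s → ∀ z, v (s • z) = s ^ 2 * v z)
    (hpos : ∀ z, F z ≠ 0 → 0 < u z ∧ 0 < v z) :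
    ∫⁻ z, F z * ENNReal.ofReal (Real.exp (-v z)) ∂μ =
      ∫⁻ z, F z * ENNReal.ofReal
        ((v z / u z) ^ (-((Module.finrank ℝ E : ℝ) / 2)) * Real.exp (-u z)) ∂μ := by
  set N : ℝ := ((Module.finrank ℝ E : ℕ) : ℝ) with hNdef
  have hN' : 0 < N := by rw [hNdef]; exact_mod_cast hN
  set J := ∫⁻ τ : ℝ, ENNReal.ofReal (Real.exp (N * τ - Real.exp (2 * τ))) with hJ
  have hJ0 : J ≠ 0 := lintegral_exp_sub_exp_ne_zero N
  have hJt : J ≠ ⊤ := lintegral_exp_sub_exp_ne_top hN'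
  -- Polar coordinates without a sphere: an auxiliary logarithmic radius `τ` is added. One double
  -- integral, computed with or without the rescaling `z ↦ exp(-τ) z`, gives `J` times either side
  -- of the claim. The factor `u^(N/2)` makes the second inner integral free of `u`.
  have hR : ∀ z, ∫⁻ τ : ℝ, F z * ENNReal.ofReal
      (u z ^ (N / 2) * Real.exp (-u z) * Real.exp (N * τ - v z * Real.exp (2 * τ))) =
      J * (F z * ENNReal.ofReal ((v z / u z) ^ (-(N / 2)) * Real.exp (-u z))) := by
    intro z
    by_cases hz : F z = 0
    · simp [hz]
    obtain ⟨h1, h2⟩ := hpos z hz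
    have : ∀ τ : ℝ, ENNReal.ofReal
        (u z ^ (N / 2) * Real.exp (-u z) * Real.exp (N * τ - v z * Real.exp (2 * τ))) =
        ENNReal.ofReal (u z ^ (N / 2) * Real.exp (-u z)) *
          ENNReal.ofReal (Real.exp (N * τ - v z * Real.exp (2 * τ))) := fun τ =>
      ENNReal.ofReal_mul (by positivity)
    simp only [this]
    rw [lintegral_const_mul _ (by fun_prop), lintegral_const_mul' _ _ ENNReal.ofReal_ne_top,
      lintegral_exp_sub_mul_exp N h2, ← hJ, ← mul_assoc (ENNReal.ofReal _),
      ← ENNReal.ofReal_mul (by positivity), mul_comm _ J, mul_left_comm]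
    congr 3
    rw [Real.div_rpow h2.le h1.le, Real.rpow_neg h1.le]
    field_simp
  have hL : ∀ z, ∫⁻ τ : ℝ, F z * ENNReal.ofReal
      (u z ^ (N / 2) * Real.exp (-v z) * Real.exp (-(N * τ) - u z * Real.exp (-(2 * τ)))) =
      J * (F z * ENNReal.ofReal (Real.exp (-v z))) := by
    intro z
    by_cases hz : F z = 0
    · simp [hz]
    obtain ⟨h1, h2⟩ := hpos z hz
    have : ∀ τ : ℝ, ENNReal.ofReal
        (u z ^ (N / 2) * Real.exp (-v z) * Real.exp (-(N * τ) - u z * Real.exp (-(2 * τ)))) =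
        ENNReal.ofReal (u z ^ (N / 2) * Real.exp (-v z)) *
          ENNReal.ofReal (Real.exp (-(N * τ) - u z * Real.exp (-(2 * τ)))) := fun τ =>
      ENNReal.ofReal_mul (by positivity)
    simp only [this]
    rw [lintegral_const_mul _ (by fun_prop), lintegral_const_mul' _ _ ENNReal.ofReal_ne_top,
      lintegral_exp_neg_sub_mul_exp_neg N h1, ← hJ, ← mul_assoc (ENNReal.ofReal _),
      ← ENNReal.ofReal_mul (by positivity), mul_comm _ J, mul_left_comm]
    congr 3
    rw [Real.rpow_neg h1.le]
    field_simp
  -- The Jacobian and the homogeneity of `u^(N/2)` each contribute `exp(-Nτ)`, turning `exp(Nτ)`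
  -- into `exp(-Nτ)`.
  have hscale : ∀ τ : ℝ, ∫⁻ z, F z * ENNReal.ofReal
      (u z ^ (N / 2) * Real.exp (-u z) * Real.exp (N * τ - v z * Real.exp (2 * τ))) ∂μ =
      ∫⁻ z, F z * ENNReal.ofReal
      (u z ^ (N / 2) * Real.exp (-v z) * Real.exp (-(N * τ) - u z * Real.exp (-(2 * τ)))) ∂μ := by
    intro τ
    rw [lintegral_eq_lintegral_smul μ (Real.exp_pos (-τ)) (by fun_prop),
      ← lintegral_const_mul' _ _ ENNReal.ofReal_ne_top]
    congr 1
    ext z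
    rw [hF' _ (Real.exp_pos _), hu' _ (Real.exp_pos _), hv' _ (Real.exp_pos _)]
    by_cases hz : F z = 0
    · simp [hz]
    obtain ⟨h1, h2⟩ := hpos z hz
    rw [mul_left_comm, ← ENNReal.ofReal_mul (by positivity)]
    congr 2
    have e2 : Real.exp (-τ) ^ 2 = Real.exp (-(2 * τ)) := by
      rw [← Real.exp_nat_mul]; congr 1; push_cast; ring
    have e3 : Real.exp (-τ) ^ Module.finrank ℝ E = Real.exp (-(N * τ)) := by
      rw [← Real.exp_nat_mul]; congr 1; rw [← hNdef]; ring
    have e4 : Real.exp (-(2 * τ)) ^ (N / 2) = Real.exp (-(N * τ)) := by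
      rw [← Real.exp_mul]; congr 1; ring
    have e5 : Real.exp (-(2 * τ)) * v z * Real.exp (2 * τ) = v z := by
      rw [mul_comm, ← mul_assoc, ← Real.exp_add]; simp
    rw [e2, e3, Real.mul_rpow (Real.exp_pos _).le h1.le, e4, e5]
    have : Real.exp (-(N * τ)) * (Real.exp (-(N * τ)) * u z ^ (N / 2) *
        Real.exp (-(Real.exp (-(2 * τ)) * u z)) * Real.exp (N * τ - v z)) =
        u z ^ (N / 2) * (Real.exp (-(N * τ)) * Real.exp (-(N * τ)) *
        Real.exp (-(Real.exp (-(2 * τ)) * u z)) * Real.exp (N * τ - v z)) := by ring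
    rw [this, mul_assoc (u z ^ (N / 2)) (Real.exp (-v z))]
    congr 1
    simp only [← Real.exp_add]
    congr 1
    ring
  have key : J * ∫⁻ z, F z * ENNReal.ofReal (Real.exp (-v z)) ∂μ = J * ∫⁻ z, F z *
      ENNReal.ofReal ((v z / u z) ^ (-(N / 2)) * Real.exp (-u z)) ∂μ := by
    calc J * ∫⁻ z, F z * ENNReal.ofReal (Real.exp (-v z)) ∂μ
        = ∫⁻ z, (∫⁻ τ : ℝ, F z * ENNReal.ofReal (u z ^ (N / 2) * Real.exp (-v z) *
            Real.exp (-(N * τ) - u z * Real.exp (-(2 * τ))))) ∂μ := by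
          rw [← lintegral_const_mul' _ _ hJt]
          exact lintegral_congr fun z => (hL z).symm
      _ = ∫⁻ τ : ℝ, ∫⁻ z, F z * ENNReal.ofReal (u z ^ (N / 2) * Real.exp (-v z) *
            Real.exp (-(N * τ) - u z * Real.exp (-(2 * τ)))) ∂μ :=
          lintegral_lintegral_swap (Measurable.aemeasurable (by fun_prop))
      _ = ∫⁻ τ : ℝ, ∫⁻ z, F z * ENNReal.ofReal (u z ^ (N / 2) * Real.exp (-u z) *
            Real.exp (N * τ - v z * Real.exp (2 * τ))) ∂μ :=
          lintegral_congr fun τ => (hscale τ).symm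
      _ = ∫⁻ z, (∫⁻ τ : ℝ, F z * ENNReal.ofReal (u z ^ (N / 2) * Real.exp (-u z) *
            Real.exp (N * τ - v z * Real.exp (2 * τ)))) ∂μ :=
          lintegral_lintegral_swap (Measurable.aemeasurable (by fun_prop))
      _ = _ := by
          rw [← lintegral_const_mul' _ _ hJt]
          exact lintegral_congr fun z => hR z
  exact (ENNReal.mul_right_inj hJ0 hJt).1 key

end Homogeneous

/-! ### Gram matrices of configurations -/

section Gram

variable {n d : ℕ} {K : Type*} [RCLike K]

/-- The matrix `∑ i, Z i (Z i)*`. -/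
def gram (Z : Fin n → Fin d → K) : Matrix (Fin d) (Fin d) K :=
  ∑ i, Matrix.vecMulVec (Z i) (star (Z i))

theorem gram_mulVec (M : Matrix (Fin d) (Fin d) K) (Z : Fin n → Fin d → K) :
    gram (fun i => M *ᵥ Z i) = M * gram Z * Mᴴ := by
  simp only [gram, Matrix.mul_sum, Matrix.sum_mul, Matrix.mul_vecMulVec, Matrix.vecMulVec_mul,
    Matrix.star_mulVec]

theorem gram_smul (s : ℝ) (Z : Fin n → Fin d → K) :
    gram (s • Z) = ((s ^ 2 : ℝ) : K) • gram Z := by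
  ext a b
  simp only [gram, Matrix.sum_apply, Matrix.smul_apply, Matrix.vecMulVec_apply, Pi.smul_apply,
    Pi.star_apply, star_smul, smul_eq_mul, Finset.mul_sum]
  refine Finset.sum_congr rfl fun i _ => ?_
  simp only [RCLike.real_smul_eq_coe_mul, star_trivial]
  push_cast
  ring

theorem gram_posSemidef (Z : Fin n → Fin d → K) : (gram Z).PosSemidef :=
  Matrix.posSemidef_sum _ fun _ _ => Matrix.posSemidef_vecMulVec_self_star _

theorem re_trace_gram (Z : Fin n → Fin d → K) :
    RCLike.re (gram Z).trace = ∑ i, ∑ j, ‖Z i j‖ ^ 2 := by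
  simp only [gram, Matrix.trace_sum, map_sum]
  refine Finset.sum_congr rfl fun i _ => ?_
  simp only [Matrix.trace_vecMulVec, dotProduct, map_sum, Pi.star_apply, RCLike.star_def,
    RCLike.mul_conj]
  refine Finset.sum_congr rfl fun j _ => ?_
  norm_cast

theorem continuous_gram : Continuous (gram : (Fin n → Fin d → K) → Matrix (Fin d) (Fin d) K) := by
  unfold gram
  refine continuous_finsetSum _ fun i _ => ?_
  exact Continuous.matrix_vecMulVec (by fun_prop) (by fun_prop)

theorem isOpen_gram_posDef : IsOpen {Z : Fin n → Fin d → K | (gram Z).PosDef} := by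
  have : {Z : Fin n → Fin d → K | (gram Z).PosDef} = {Z | (gram Z).det ≠ 0} := by
    ext Z
    exact (gram_posSemidef Z).posDef_iff_det_ne_zero
  rw [this]
  exact isOpen_ne_fun (Continuous.matrix_det continuous_gram) continuous_const

theorem nonempty_gram_posDef (h : d ≤ n) : {Z : Fin n → Fin d → K | (gram Z).PosDef}.Nonempty := by
  -- The first `d` vectors form the standard basis and the others vanish.
  refine ⟨fun i j => if i = Fin.castLE h j then 1 else 0, ?_⟩
  have : gram (fun i j => if i = Fin.castLE h j then (1 : K) else 0) = 1 := by
    ext a b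
    simp only [gram, Matrix.sum_apply, Matrix.vecMulVec_apply, Pi.star_apply, Matrix.one_apply]
    rw [Finset.sum_eq_single (Fin.castLE h a)]
    · simp [(Fin.castLE_injective h).eq_iff]
    · intro i _ hi
      simp [hi]
    · simp
  rw [Set.mem_ofPred_eq, this]
  exact Matrix.PosDef.one

theorem re_trace_pos (hd : 0 < d) {X : Matrix (Fin d) (Fin d) K} (hX : X.PosDef) :
    0 < RCLike.re X.trace := by
  have : Nonempty (Fin d) := ⟨⟨0, hd⟩⟩
  exact (RCLike.pos_iff.1 hX.trace_pos).1

theorem finrank_config : Module.finrank ℝ (Fin n → Fin d → K) = n * (d * Module.finrank ℝ K) := by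
  simp [Module.finrank_pi_fintype]

theorem continuous_re_trace : Continuous fun x : UnitPDMat d K => RCLike.re x.1.trace :=
  RCLike.continuous_re.comp (Continuous.matrix_trace continuous_subtype_val)

end Gram

/-! ### Invariance of Lebesgue measure under multiplication by `SL_d(K)` -/

section Volume

variable {n d : ℕ} {K : Type*} [RCLike K] [MeasurableSpace K] [BorelSpace K]

instance isAddHaarMeasure_volume_vec : (volume : Measure (Fin d → K)).IsAddHaarMeasure :=
  inferInstanceAs (Measure.pi fun _ : Fin d => (volume : Measure K)).IsAddHaarMeasure

instance isAddHaarMeasure_volume_config :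
    (volume : Measure (Fin n → Fin d → K)).IsAddHaarMeasure :=
  @Measure.pi.isAddHaarMeasure _ _ _ _ (fun _ => (volume : Measure (Fin d → K))) _ _ _ _ _

theorem measurePreserving_linearMap {E : Type*} [NormedAddCommGroup E] [NormedSpace ℝ E]
    [FiniteDimensional ℝ E] [MeasurableSpace E] [BorelSpace E] (μ : Measure E)
    [μ.IsAddHaarMeasure] (f : E →ₗ[ℝ] E) (hf : |LinearMap.det f| = 1) :
    MeasurePreserving f μ μ := by
  refine ⟨f.continuous_of_finiteDimensional.measurable, ?_⟩
  have h0 : LinearMap.det f ≠ 0 := by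
    intro h
    rw [h] at hf
    simp at hf
  rw [Measure.map_linearMap_addHaar_eq_smul_addHaar μ h0, abs_inv, hf]
  simp

theorem measurePreserving_mulVec (g : Matrix.SpecialLinearGroup (Fin d) K) :
    MeasurePreserving (fun z : Fin d → K => g.1 *ᵥ z) := by
  refine measurePreserving_linearMap volume ((Matrix.toLin' g.1).restrictScalars ℝ) ?_
  -- The real determinant is the norm from `K` to `ℝ` of the determinant over `K`.
  rw [LinearMap.det_restrictScalars, LinearMap.det_toLin', g.2, map_one, abs_one]

theorem measurePreserving_rows (g : Matrix.SpecialLinearGroup (Fin d) K) :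
    MeasurePreserving (fun (Z : Fin n → Fin d → K) i => g.1 *ᵥ Z i) :=
  volume_preserving_pi fun _ => measurePreserving_mulVec g

/-- An involution has determinant `±1`. Transposition carries right multiplication to left
multiplication. -/
theorem measurePreserving_transpose :
    MeasurePreserving (fun (Z : Fin d → Fin d → K) i j => Z j i) := by
  let f : (Fin d → Fin d → K) →ₗ[ℝ] (Fin d → Fin d → K) :=
    { toFun := fun Z i j => Z j i
      map_add' := fun _ _ => rfl
      map_smul' := fun _ _ => rfl }
  have hf : f * f = 1 := rfl
  refine measurePreserving_linearMap volume f ?_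
  have := congrArg LinearMap.det hf
  rw [map_mul, map_one] at this
  have h2 : |LinearMap.det f| * |LinearMap.det f| = 1 := by rw [← abs_mul, this, abs_one]
  nlinarith [abs_nonneg (LinearMap.det f)]

theorem measurePreserving_mul_right (g : Matrix.SpecialLinearGroup (Fin d) K) :
    MeasurePreserving (fun Z : Fin d → Fin d → K => Matrix.of.symm (Matrix.of Z * g.1)) volume
      volume := by
  have e : (fun Z : Fin d → Fin d → K => Matrix.of.symm (Matrix.of Z * g.1)) =
      fun Z i => g.transpose.1 *ᵥ Z i := by
    funext Z i j
    simp [Matrix.mul_apply, Matrix.mulVec, dotProduct, mul_comm]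
  rw [e]
  exact measurePreserving_rows g.transpose

theorem measurePreserving_mul_left (g : Matrix.SpecialLinearGroup (Fin d) K) :
    MeasurePreserving (fun Z : Fin d → Fin d → K => Matrix.of.symm (g.1 * Matrix.of Z)) volume
      volume := by
  exact (measurePreserving_transpose (d := d) (K := K)).comp
    ((measurePreserving_rows (n := d) g).comp measurePreserving_transpose)

end Volume

/-! ### An invariant measure, and the density of the standard law against it -/

section Cone

variable (n d : ℕ) (K : Type*) [RCLike K] [MeasurableSpace K] [BorelSpace K]

/-- The degree two homogeneous weight `det (gram Z) ^ (1/d)`. -/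
noncomputable def detWeight {n d : ℕ} {K : Type*} [RCLike K] (Z : Fin n → Fin d → K) : ℝ :=
  RCLike.re (gram Z).det ^ (1 / (d : ℝ))

/-- The image under `Z ↦ projT (gram Z)` of the measure with density `exp (-detWeight Z)` on
configurations of full rank. -/
noncomputable def coneMeasure : Measure (UnitPDMat d K) :=
  (((volume : Measure (Fin n → Fin d → K)).restrict {Z | (gram Z).PosDef}).withDensity
    fun Z => ENNReal.ofReal (Real.exp (-detWeight Z))).map (fun Z => projT (gram Z))

variable {n d K}

theorem measurable_detWeight : Measurable (detWeight : (Fin n → Fin d → K) → ℝ) :=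
  Measurable.pow_const (RCLike.continuous_re.comp
    (Continuous.matrix_det continuous_gram)).measurable _

theorem measurable_projT_gram :
    Measurable (fun Z : Fin n → Fin d → K => projT (gram Z)) :=
  measurable_projT.comp continuous_gram.measurable

theorem lintegral_coneMeasure {φ : UnitPDMat d K → ENNReal} (hφ : Measurable φ) :
    ∫⁻ x, φ x ∂(coneMeasure n d K) = ∫⁻ Z : Fin n → Fin d → K, {Z | (gram Z).PosDef}.indicator
      (fun Z => φ (projT (gram Z)) * ENNReal.ofReal (Real.exp (-detWeight Z))) Z := by
  have hw : Measurable fun Z : Fin n → Fin d → K =>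
      ENNReal.ofReal (Real.exp (-detWeight Z)) :=
    measurable_detWeight.neg.exp.ennreal_ofReal
  have hψ : Measurable fun Z : Fin n → Fin d → K => φ (projT (gram Z)) :=
    hφ.comp measurable_projT_gram
  rw [coneMeasure, lintegral_map hφ measurable_projT_gram,
    lintegral_withDensity_eq_lintegral_mul _ hw hψ,
    lintegral_indicator isOpen_gram_posDef.measurableSet]
  refine lintegral_congr fun Z => ?_
  simp [mul_comm]

/-- The change of variables `Z ↦ gZ` preserves Lebesgue measure and the determinant of the Gram
matrix, and it intertwines the projection with the action. -/
theorem map_slAct_coneMeasure (hd : 0 < d) (g : Matrix.SpecialLinearGroup (Fin d) K) :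
    (coneMeasure n d K).map (slAct g) = coneMeasure n d K := by
  refine Measure.ext_of_lintegral _ fun φ hφ => ?_
  have hg : Measurable (slAct g) := (continuous_slAct g).measurable
  have hψ : Measurable fun x => φ (slAct g x) := hφ.comp hg
  have hH : Measurable ({Z : Fin n → Fin d → K | (gram Z).PosDef}.indicator fun Z =>
      φ (projT (gram Z)) * ENNReal.ofReal (Real.exp (-detWeight Z))) := by
    refine Measurable.indicator ?_ isOpen_gram_posDef.measurableSet
    exact (hφ.comp measurable_projT_gram).mul measurable_detWeight.neg.exp.ennreal_ofReal
  rw [lintegral_map hφ hg, lintegral_coneMeasure hψ, lintegral_coneMeasure hφ,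
    ← (measurePreserving_rows (n := n) g).lintegral_comp hH]
  · refine lintegral_congr fun Z => ?_
    have hu : IsUnit g.1.det := by rw [g.2]; exact isUnit_one
    by_cases h : (gram Z).PosDef
    · have h' : (gram fun i => g.1 *ᵥ Z i).PosDef := by
        rw [gram_mulVec]; exact (posDef_conj_iff hu _).2 h
      rw [Set.indicator_of_mem (by exact h), Set.indicator_of_mem (by exact h'), detWeight,
        detWeight, gram_mulVec, projT_slAct hd g h, Matrix.det_mul, Matrix.det_mul,
        Matrix.det_conjTranspose, g.2]
      simp
    · have h' : ¬ (gram fun i => g.1 *ᵥ Z i).PosDef := by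
        rw [gram_mulVec]; exact fun h' => h ((posDef_conj_iff hu _).1 h')
      rw [Set.indicator_of_notMem (by exact h), Set.indicator_of_notMem (by exact h')]

theorem coneMeasure_ne_zero (h : d ≤ n) : coneMeasure n d K ≠ 0 := by
  intro h0
  have h1 := lintegral_coneMeasure (n := n) (d := d) (K := K) (φ := fun _ => 1) measurable_const
  rw [h0, lintegral_zero_measure, eq_comm, lintegral_eq_zero_iff] at h1
  · have h2 : volume {Z : Fin n → Fin d → K | (gram Z).PosDef} = 0 := by
      refine measure_mono_null (fun Z hZ => ?_) h1
      simp only [Set.mem_compl_iff, Set.mem_ofPred_eq, one_mul]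
      intro h3
      have h4 : ENNReal.ofReal (Real.exp (-detWeight Z)) = 0 := by
        simpa [Set.indicator_of_mem hZ] using h3
      rw [ENNReal.ofReal_eq_zero] at h4
      exact absurd h4 (not_le.2 (Real.exp_pos _))
    exact (isOpen_gram_posDef.measure_pos volume (nonempty_gram_posDef h)).ne' h2
  · refine Measurable.indicator ?_ isOpen_gram_posDef.measurableSet
    exact measurable_const.mul measurable_detWeight.neg.exp.ennreal_ofReal

/-- The law of `projT (gram Z)` for a standard Gaussian `Z`. -/
noncomputable def stdProj (n d : ℕ) (K : Type*) [RCLike K] [MeasurableSpace K] [BorelSpace K] :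
    Measure (UnitPDMat d K) :=
  ((Measure.pi fun _ : Fin n => Measure.pi fun _ : Fin d => scalarGaussian K).restrict
    {Z | (gram Z).PosDef}).map (fun Z => projT (gram Z))

instance : IsFiniteMeasure (stdProj n d K) := by unfold stdProj; infer_instance

/-- The weights `(k/2) tr G` and `det(G)^(1/d)` are both of degree two, and their ratio is `(k/2)
tr(projT G)`, a function of the projected point alone. The exponent is half the real dimension `ndk`
of the space of configurations. -/
theorem exists_stdProj_eq (hd : 0 < d) (hn : 0 < n) :
    ∃ C : ENNReal, C ≠ 0 ∧ C ≠ ⊤ ∧ stdProj n d K = C • (coneMeasure n d K).withDensity fun x =>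
      ENNReal.ofReal (RCLike.re x.1.trace ^ (-((d : ℝ) * Module.finrank ℝ K * n / 2))) := by
  obtain ⟨C, h0, ht, h⟩ := hasExpDensity_pi_scalarGaussian K n d
  have hk : (0 : ℝ) < Module.finrank ℝ K := by
    exact_mod_cast Module.finrank_pos (R := ℝ) (M := K)
  set k : ℝ := ((Module.finrank ℝ K : ℕ) : ℝ) with hkdef
  set m : ℝ := (d : ℝ) * k * n / 2 with hm
  have hc : 0 < (k / 2) ^ (-m) := by positivity
  refine ⟨C * ENNReal.ofReal ((k / 2) ^ (-m)), mul_ne_zero h0 (by simpa using hc),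
    ENNReal.mul_ne_top ht ENNReal.ofReal_ne_top, ?_⟩
  have htr : Measurable fun x : UnitPDMat d K => ENNReal.ofReal (RCLike.re x.1.trace ^ (-m)) :=
    (continuous_re_trace.measurable.pow_const _).ennreal_ofReal
  ext A hA
  -- Homogeneous of degree zero, because `projT` is invariant under positive scaling.
  set F : (Fin n → Fin d → K) → ENNReal :=
    ({Z | (gram Z).PosDef} ∩ (fun Z => projT (gram Z)) ⁻¹' A).indicator 1 with hFdef
  have hFset : MeasurableSet ({Z : Fin n → Fin d → K | (gram Z).PosDef} ∩
      (fun Z => projT (gram Z)) ⁻¹' A) :=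
    isOpen_gram_posDef.measurableSet.inter (measurable_projT_gram hA)
  have hF : Measurable F := measurable_one.indicator hFset
  have hNpos : 0 < Module.finrank ℝ (Fin n → Fin d → K) := by
    rw [finrank_config]
    exact Nat.mul_pos hn (Nat.mul_pos hd Module.finrank_pos)
  have hN2 : (Module.finrank ℝ (Fin n → Fin d → K) : ℝ) / 2 = m := by
    rw [finrank_config, hm, hkdef]; push_cast; ring
  have hd' : (d : ℝ) ≠ 0 := by exact_mod_cast hd.ne'
  have hFmem : ∀ Z, F Z ≠ 0 → (gram Z).PosDef := fun Z hZ =>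
    (Set.mem_of_indicator_ne_zero hZ).1
  have key := lintegral_exp_neg_homogeneous (volume : Measure (Fin n → Fin d → K)) hNpos hF
    (u := detWeight) (v := fun Z => k / 2 * RCLike.re (gram Z).trace)
    (by
      intro s hs Z
      have hs2 : 0 < s ^ 2 := by positivity
      have : s • Z ∈ ({Z : Fin n → Fin d → K | (gram Z).PosDef} ∩
          (fun Z => projT (gram Z)) ⁻¹' A) ↔ Z ∈ ({Z : Fin n → Fin d → K | (gram Z).PosDef} ∩
          (fun Z => projT (gram Z)) ⁻¹' A) := by
        simp only [Set.mem_inter_iff, Set.mem_ofPred_eq, Set.mem_preimage, gram_smul,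
          projT_smul hd _ hs2, posDef_real_smul_iff hs2]
      classical
      simp only [hFdef, Set.indicator_apply, this, Pi.one_apply])
    measurable_detWeight
    ((RCLike.continuous_re.comp (Continuous.matrix_trace continuous_gram)).measurable.const_mul _)
    (by
      intro s hs Z
      have h3 : 0 ≤ RCLike.re (gram Z).det :=
        (RCLike.nonneg_iff.1 (gram_posSemidef Z).det_nonneg).1
      rw [detWeight, detWeight, gram_smul, re_det_real_smul,
        Real.mul_rpow (by positivity) h3, ← Real.rpow_natCast (s ^ 2) d,
        ← Real.rpow_mul (by positivity), mul_one_div_cancel hd', Real.rpow_one])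
    (by
      intro s hs Z
      rw [gram_smul, Matrix.trace_smul, smul_eq_mul, RCLike.re_ofReal_mul]
      ring)
    (by
      intro Z hZ
      have h1 := hFmem Z hZ
      exact ⟨Real.rpow_pos_of_pos (re_det_pos h1) _, mul_pos (by positivity)
        (re_trace_pos hd h1)⟩)
  rw [stdProj, Measure.map_apply measurable_projT_gram hA,
    Measure.restrict_apply (measurable_projT_gram hA), Set.inter_comm, h, Measure.smul_apply,
    withDensity_apply _ hFset, ← lintegral_indicator hFset, Measure.smul_apply,
    withDensity_apply _ hA, ← lintegral_indicator hA, lintegral_coneMeasure (htr.indicator hA),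
    smul_eq_mul, smul_eq_mul, mul_assoc]
  congr 1
  rw [← lintegral_const_mul' _ _ ENNReal.ofReal_ne_top]
  refine Eq.trans ?_ (key.trans ?_)
  · refine lintegral_congr fun Z => ?_
    classical
    rw [hFdef]
    simp only [Set.indicator_apply, re_trace_gram]
    split_ifs <;> simp
  · refine lintegral_congr fun Z => ?_
    by_cases hZ : F Z = 0
    · rw [hZ, zero_mul]
      by_cases h1 : (gram Z).PosDef
      · have h2 : projT (gram Z) ∉ A := by
          intro h2
          have : F Z = 1 := Set.indicator_of_mem (by exact ⟨h1, h2⟩) _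
          rw [this] at hZ
          exact one_ne_zero hZ
        rw [Set.indicator_of_mem (by exact h1), Set.indicator_of_notMem h2, zero_mul, mul_zero]
      · rw [Set.indicator_of_notMem (by exact h1), mul_zero]
    · have hmem := Set.mem_of_indicator_ne_zero hZ
      have h1 : (gram Z).PosDef := hmem.1
      have h2 : projT (gram Z) ∈ A := hmem.2
      have hF1 : F Z = 1 := Set.indicator_of_mem hmem _
      have hdet := re_det_pos h1
      have htrp := re_trace_pos hd h1
      rw [Set.indicator_of_mem (by exact h1), Set.indicator_of_mem h2, hF1, one_mul,
        ← ENNReal.ofReal_mul (Real.rpow_pos_of_pos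
          (re_trace_pos hd (projT (gram Z)).2.1) _).le, ← ENNReal.ofReal_mul hc.le, hN2,
        ← mul_assoc]
      congr 2
      rw [coe_projT h1, Matrix.trace_smul, smul_eq_mul, RCLike.re_ofReal_mul,
        ← Real.mul_rpow (by positivity) (by positivity)]
      congr 1
      rw [detWeight, Real.rpow_neg hdet.le]
      field_simp

/-- The standard law is finite, and its density against the cone measure is continuous and positive,
hence bounded below near each point. -/
theorem isLocallyFinite_coneMeasure (hd : 0 < d) (hn : 0 < n) :
    IsLocallyFiniteMeasure (coneMeasure n d K) := by
  obtain ⟨C, h0, ht, h⟩ := exists_stdProj_eq (K := K) hd hn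
  set m : ℝ := (d : ℝ) * Module.finrank ℝ K * n / 2
  have hcont : Continuous fun x : UnitPDMat d K => RCLike.re x.1.trace ^ (-m) :=
    continuous_re_trace.rpow_const fun x => Or.inl (re_trace_pos hd x.2.1).ne'
  refine ⟨fun x => ?_⟩
  have hx : 0 < RCLike.re x.1.trace ^ (-m) := Real.rpow_pos_of_pos (re_trace_pos hd x.2.1) _
  set U : Set (UnitPDMat d K) :=
    {y | RCLike.re x.1.trace ^ (-m) / 2 < RCLike.re y.1.trace ^ (-m)}
  have hU : IsOpen U := isOpen_lt continuous_const hcont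
  refine ⟨U, hU.mem_nhds (half_lt_self hx), ?_⟩
  set ε := ENNReal.ofReal (RCLike.re x.1.trace ^ (-m) / 2)
  have hε : ε ≠ 0 := by
    rw [Ne, ENNReal.ofReal_eq_zero, not_le]; positivity
  have h1 : C * (ε * coneMeasure n d K U) ≤ stdProj n d K U := by
    rw [h, Measure.smul_apply, smul_eq_mul, withDensity_apply _ hU.measurableSet,
      ← setLIntegral_const]
    gcongr 1
    refine setLIntegral_mono' hU.measurableSet fun y hy => ?_
    exact ENNReal.ofReal_le_ofReal (le_of_lt hy)
  by_contra h2
  rw [not_lt, top_le_iff] at h2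
  rw [h2, ENNReal.mul_top hε, ENNReal.mul_top h0, top_le_iff] at h1
  exact measure_ne_top _ _ h1

theorem isInvariantVolume_coneMeasure (hd : 0 < d) (hn : d ≤ n) :
    IsInvariantVolume (coneMeasure n d K) :=
  ⟨coneMeasure_ne_zero hn, isLocallyFinite_coneMeasure hd (hd.trans_le hn),
    map_slAct_coneMeasure hd⟩

end Cone

/-! ### Uniqueness of the invariant measure up to a factor -/

section Uniqueness

/-- The map `r ↦ r^d` has derivative `d ≠ 0` at `1`, so it is open there. Matrices with determinant
in `D` are scalar multiples of elements of `SL_d(K)`, and the bound on `r` later controls a Gaussian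
integral. -/
theorem exists_nhds_one_pow {d : ℕ} (hd : 0 < d) (K : Type*) [RCLike K] :
    ∃ D : Set K, IsOpen D ∧ 1 ∈ D ∧ ∀ z ∈ D, ∃ r : K, r ≠ 0 ∧ ‖r‖ ≤ 2 ∧ z = r ^ d := by
  have h1 : HasStrictDerivAt (fun r : K => r ^ d) (d * 1 ^ (d - 1)) 1 := hasStrictDerivAt_pow d 1
  have h2 := h1.map_nhds_eq (by simpa using hd.ne')
  have h3 : (fun r : K => r ^ d) '' Metric.ball 1 1 ∈ nhds (1 : K) := by
    have := Filter.image_mem_map (m := fun r : K => r ^ d) (Metric.ball_mem_nhds (1 : K) one_pos)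
    rw [h2] at this
    simpa using this
  obtain ⟨D, hD, hDo, h1D⟩ := mem_nhds_iff.1 h3
  refine ⟨D, hDo, h1D, fun z hz => ?_⟩
  obtain ⟨r, hr, rfl⟩ := hD hz
  rw [Metric.mem_ball, dist_eq_norm] at hr
  refine ⟨r, ?_, ?_, rfl⟩
  · rintro rfl
    simp at hr
  · have := norm_add_le (r - 1) 1
    rw [sub_add_cancel, norm_one] at this
    linarith

theorem measurable_matrix_of {d : ℕ} {K : Type*} [MeasurableSpace K] :
    Measurable fun Z : Fin d → Fin d → K => (Matrix.of Z : Matrix (Fin d) (Fin d) K) :=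
  measurable_id

variable {d : ℕ} {K : Type*} [RCLike K]

/-- The matrices with determinant in `D`. -/
def detIn (d : ℕ) {K : Type*} [RCLike K] (D : Set K) : Set (Fin d → Fin d → K) :=
  {Z | (Matrix.of Z).det ∈ D}

theorem continuous_det_of : Continuous fun Z : Fin d → Fin d → K => (Matrix.of Z).det :=
  Continuous.matrix_det continuous_id

theorem isOpen_detIn {D : Set K} (hD : IsOpen D) : IsOpen (detIn d D) :=
  hD.preimage continuous_det_of

theorem continuousOn_coe_projT :
    ContinuousOn (projT : Matrix (Fin d) (Fin d) K → UnitPDMat d K) {X | X.PosDef} := by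
  refine Topology.IsInducing.subtypeVal.continuousOn_iff.2 ?_
  have h0 : Continuous fun X : Matrix (Fin d) (Fin d) K => RCLike.re X.det :=
    RCLike.continuous_re.comp (Continuous.matrix_det continuous_id)
  have h1 : ContinuousOn (fun X : Matrix (Fin d) (Fin d) K =>
      RCLike.re X.det ^ (-(1 / (d : ℝ)))) {X | X.PosDef} :=
    h0.continuousOn.rpow_const fun X hX => Or.inl (re_det_pos hX).ne'
  have h : ContinuousOn (fun X : Matrix (Fin d) (Fin d) K =>
      ((RCLike.re X.det ^ (-(1 / (d : ℝ))) : ℝ) : K) • X) {X | X.PosDef} :=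
    ContinuousOn.fun_smul (RCLike.continuous_ofReal.comp_continuousOn h1) continuousOn_id
  exact h.congr fun X hX => coe_projT hX

/-- The action of the adjugate of a matrix. -/
noncomputable def coact (M : Matrix (Fin d) (Fin d) K) (x : UnitPDMat d K) : UnitPDMat d K :=
  act M.adjugate x

attribute [irreducible] coact

theorem act_mul_slAct_inv (A : Matrix (Fin d) (Fin d) K) (h : Matrix.SpecialLinearGroup (Fin d) K)
    (x : UnitPDMat d K) : act (A * h.1.adjugate) (slAct h x) = act A x := by
  have h1 : h.1.adjugate * h.1 = 1 := by rw [Matrix.adjugate_mul, h.2, one_smul]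
  have h2 : h.1ᴴ * h.1.adjugateᴴ = 1 := by
    rw [← Matrix.conjTranspose_mul, h1, Matrix.conjTranspose_one]
  rw [act, act, slAct]
  congr 1
  calc A * h.1.adjugate * (h.1 * x.1 * h.1ᴴ) * (A * h.1.adjugate)ᴴ
      = A * (h.1.adjugate * h.1) * x.1 * (h.1ᴴ * h.1.adjugateᴴ) * Aᴴ := by
        simp only [Matrix.conjTranspose_mul, Matrix.mul_assoc]
    _ = A * x.1 * Aᴴ := by rw [h1, h2, Matrix.mul_one, Matrix.mul_one]

theorem act_slAct (A : Matrix (Fin d) (Fin d) K) (h : Matrix.SpecialLinearGroup (Fin d) K)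
    (x : UnitPDMat d K) : act A (slAct h x) = act (A * h.1) x := by
  rw [act, act, slAct]
  congr 1
  simp only [Matrix.conjTranspose_mul, Matrix.mul_assoc]

/-- A test function, decaying fast in the inverse matrix. -/
noncomputable def invTraceWeight (x : UnitPDMat d K) : ENNReal :=
  ENNReal.ofReal (Real.exp (-(2 * Module.finrank ℝ K * RCLike.re x.1.adjugate.trace)))

theorem invTraceWeight_ne_zero (x : UnitPDMat d K) : invTraceWeight x ≠ 0 := by
  rw [invTraceWeight, Ne, ENNReal.ofReal_eq_zero, not_le]
  exact Real.exp_pos _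

variable [MeasurableSpace K]

instance : SecondCountableTopology (Matrix (Fin d) (Fin d) K) :=
  inferInstanceAs (SecondCountableTopology (Fin d → Fin d → K))

instance : SecondCountableTopology (UnitPDMat d K) :=
  TopologicalSpace.Subtype.secondCountableTopology _

theorem IsInvariantVolume.sigmaFinite {ν : Measure (UnitPDMat d K)} (hν : IsInvariantVolume ν) :
    SigmaFinite ν :=
  have := hν.locallyFinite
  inferInstance

variable [BorelSpace K]

theorem IsInvariantVolume.lintegral_slAct {ν : Measure (UnitPDMat d K)}
    (hν : IsInvariantVolume ν) (g : Matrix.SpecialLinearGroup (Fin d) K)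
    {φ : UnitPDMat d K → ENNReal} (hφ : Measurable φ) :
    ∫⁻ x, φ (slAct g x) ∂ν = ∫⁻ x, φ x ∂ν := by
  conv_rhs => rw [← hν.invariant g]
  rw [lintegral_map hφ (continuous_slAct g).measurable]

theorem measurable_act :
    Measurable fun p : Matrix (Fin d) (Fin d) K × UnitPDMat d K => act p.1 p.2 := by
  have h : Continuous fun p : Matrix (Fin d) (Fin d) K × UnitPDMat d K =>
      p.1 * p.2.1 * p.1ᴴ := by
    have h2 : Continuous fun p : Matrix (Fin d) (Fin d) K × UnitPDMat d K => p.2.1 :=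
      continuous_subtype_val.comp continuous_snd
    exact (continuous_fst.matrix_mul h2).matrix_mul continuous_fst.matrix_conjTranspose
  unfold act
  exact measurable_projT.comp h.measurable


theorem measurable_adjugate :
    Measurable fun M : Matrix (Fin d) (Fin d) K => M.adjugate :=
  (Continuous.matrix_adjugate continuous_id).measurable

theorem measurable_act_of :
    Measurable fun p : (Fin d → Fin d → K) × UnitPDMat d K => act (Matrix.of p.1) p.2 :=
  measurable_act.comp ((measurable_matrix_of.comp measurable_fst).prodMk measurable_snd)

theorem measurable_coact :
    Measurable fun p : Matrix (Fin d) (Fin d) K × UnitPDMat d K => coact p.1 p.2 := by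
  have h : Measurable fun p : Matrix (Fin d) (Fin d) K × UnitPDMat d K => (p.1.adjugate, p.2) :=
    (measurable_adjugate.comp measurable_fst).prodMk measurable_snd
  unfold coact
  exact measurable_act.comp h

theorem measurable_coact_of :
    Measurable fun p : (Fin d → Fin d → K) × UnitPDMat d K => coact (Matrix.of p.1) p.2 :=
  measurable_coact.comp ((measurable_matrix_of.comp measurable_fst).prodMk measurable_snd)

theorem measurable_act_of_left (x : UnitPDMat d K) :
    Measurable fun Z : Fin d → Fin d → K => act (Matrix.of Z) x :=
  measurable_act_of.comp (measurable_id.prodMk measurable_const)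

theorem measurable_coact_of_left (x : UnitPDMat d K) :
    Measurable fun Z : Fin d → Fin d → K => coact (Matrix.of Z) x :=
  measurable_coact_of.comp (measurable_id.prodMk measurable_const)

/-- Integral of a function over the orbit of the base point, parametrized by matrices. -/
noncomputable def orbitIntegral (D : Set K) (φ : UnitPDMat d K → ENNReal) : ENNReal :=
  ∫⁻ Z in detIn d D, φ (act (Matrix.of Z) basePt)

/-- Integral of a function over the orbit of the base point, parametrized by inverse matrices. -/
noncomputable def inverseOrbitIntegral (D : Set K) (φ : UnitPDMat d K → ENNReal) : ENNReal :=
  ∫⁻ Z in detIn d D, φ (coact (Matrix.of Z) basePt)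

/-- By transitivity `x = h · 1`, and right multiplication by `h` preserves both Lebesgue measure and
the determinant. -/
theorem lintegral_act (hd : 0 < d) {D : Set K} (hD : IsOpen D) {φ : UnitPDMat d K → ENNReal}
    (hφ : Measurable φ) (x : UnitPDMat d K) :
    ∫⁻ Z in detIn d D, φ (act (Matrix.of Z) x) = orbitIntegral D φ := by
  obtain ⟨h, rfl⟩ := exists_slAct_basePt hd x
  have hp := (measurePreserving_mul_right h).restrict_preimage
    (isOpen_detIn (d := d) hD).measurableSet
  have hpre : (fun Z : Fin d → Fin d → K => Matrix.of.symm (Matrix.of Z * h.1)) ⁻¹' (detIn d D) =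
      detIn d D := by
    ext Z
    simp only [detIn, Set.mem_preimage, Set.mem_ofPred_eq, Equiv.apply_symm_apply, Matrix.det_mul,
      h.2, mul_one]
  rw [hpre] at hp
  have hm : Measurable fun Z : Fin d → Fin d → K => φ (act (Matrix.of Z) basePt) :=
    hφ.comp (measurable_act_of_left _)
  rw [orbitIntegral, ← hp.lintegral_comp hm]
  refine lintegral_congr fun Z => ?_
  rw [act_slAct]
  rfl

/-- The adjugate reverses products, so left multiplication by `h` now absorbs the base point. -/
theorem lintegral_coact (hd : 0 < d) {D : Set K} (hD : IsOpen D)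
    {φ : UnitPDMat d K → ENNReal} (hφ : Measurable φ) (x : UnitPDMat d K) :
    ∫⁻ Z in detIn d D, φ (coact (Matrix.of Z) x) = inverseOrbitIntegral D φ := by
  obtain ⟨h, rfl⟩ := exists_slAct_basePt hd x
  have hp := (measurePreserving_mul_left h).restrict_preimage
    (isOpen_detIn (d := d) hD).measurableSet
  have hpre : (fun Z : Fin d → Fin d → K => Matrix.of.symm (h.1 * Matrix.of Z)) ⁻¹' (detIn d D) =
      detIn d D := by
    ext Z
    simp only [detIn, Set.mem_preimage, Set.mem_ofPred_eq, Equiv.apply_symm_apply, Matrix.det_mul,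
      h.2, one_mul]
  rw [hpre] at hp
  have hm : Measurable fun Z : Fin d → Fin d → K =>
      φ (coact (Matrix.of Z) (slAct h basePt)) :=
    hφ.comp (measurable_coact_of_left _)
  rw [inverseOrbitIntegral, ← hp.lintegral_comp hm]
  refine lintegral_congr fun Z => ?_
  rw [coact, coact, Equiv.apply_symm_apply, Matrix.adjugate_mul_distrib, act_mul_slAct_inv]

/-- Weil's argument: integrate `φ(x) ψ(Z⁻¹x)` over `Z` and `x`. Integrating `Z` first gives the left
side. For fixed `Z`, invariance of `ν` turns the integrand into `φ(Zx) ψ(x)`, which gives the right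
side. -/
theorem IsInvariantVolume.lintegral_mul {ν : Measure (UnitPDMat d K)} (hν : IsInvariantVolume ν)
    (hd : 0 < d) {D : Set K} (hD : IsOpen D) (hroot : ∀ z ∈ D, ∃ r : K, r ≠ 0 ∧ z = r ^ d)
    {φ ψ : UnitPDMat d K → ENNReal} (hφ : Measurable φ) (hψ : Measurable ψ) :
    (∫⁻ x, φ x ∂ν) * inverseOrbitIntegral D ψ = (∫⁻ x, ψ x ∂ν) * orbitIntegral D φ := by
  have := hν.sigmaFinite
  have hm : ∀ x, Measurable fun Z : Fin d → Fin d → K => φ (act (Matrix.of Z) x) := fun x =>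
    hφ.comp (measurable_act_of_left x)
  have hm' : ∀ x, Measurable fun Z : Fin d → Fin d → K => ψ (coact (Matrix.of Z) x) :=
    fun x => hψ.comp (measurable_coact_of_left x)
  have hψ' : Measurable fun p : UnitPDMat d K × (Fin d → Fin d → K) =>
      φ p.1 * ψ (coact (Matrix.of p.2) p.1) :=
    (hφ.comp measurable_fst).mul (hψ.comp (measurable_coact_of.comp measurable_swap))
  have hφ' : Measurable fun p : (Fin d → Fin d → K) × UnitPDMat d K =>
      ψ p.2 * φ (act (Matrix.of p.1) p.2) :=
    (hψ.comp measurable_snd).mul (hφ.comp measurable_act_of)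
  calc (∫⁻ x, φ x ∂ν) * inverseOrbitIntegral D ψ
      = ∫⁻ x, φ x * inverseOrbitIntegral D ψ ∂ν := (lintegral_mul_const _ hφ).symm
    _ = ∫⁻ x, (∫⁻ Z in detIn d D, φ x * ψ (coact (Matrix.of Z) x)) ∂ν := by
        refine lintegral_congr fun x => ?_
        rw [lintegral_const_mul _ (hm' x), lintegral_coact hd hD hψ]
    _ = ∫⁻ Z in detIn d D, (∫⁻ x, φ x * ψ (coact (Matrix.of Z) x) ∂ν) :=
        lintegral_lintegral_swap hψ'.aemeasurable
    _ = ∫⁻ Z in detIn d D, (∫⁻ x, ψ x * φ (act (Matrix.of Z) x) ∂ν) := by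
        refine setLIntegral_congr_fun (isOpen_detIn hD).measurableSet fun Z hZ => ?_
        obtain ⟨r, hr, hrd⟩ := hroot _ hZ
        obtain ⟨g, hg, hg'⟩ := exists_eq_smul hr hrd
        have hm2 : Measurable fun x => φ x * ψ (slAct g⁻¹ x) :=
          hφ.mul (hψ.comp (continuous_slAct g⁻¹).measurable)
        simp only [coact, hg', act_smul hd (pow_ne_zero _ hr)]
        simp only [hg, act_smul hd hr]
        -- With `Z = r g`, substituting `x ↦ g x` moves the translate from `ψ` to `φ`.
        rw [← hν.lintegral_slAct g hm2]
        refine lintegral_congr fun x => ?_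
        rw [← slAct_mul, inv_mul_cancel, slAct_one, mul_comm]
    _ = ∫⁻ x, (∫⁻ Z in detIn d D, ψ x * φ (act (Matrix.of Z) x)) ∂ν :=
        lintegral_lintegral_swap hφ'.aemeasurable
    _ = ∫⁻ x, ψ x * orbitIntegral D φ ∂ν := by
        refine lintegral_congr fun x => ?_
        rw [lintegral_const_mul _ (hm x), lintegral_act hd hD hφ]
    _ = (∫⁻ x, ψ x ∂ν) * orbitIntegral D φ := lintegral_mul_const _ hψ

theorem orbitIntegral_indicator_ne_zero (hd : 0 < d) {D : Set K} (hD : IsOpen D) (h1 : (1 : K) ∈ D)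
    (hroot : ∀ z ∈ D, ∃ r : K, r ≠ 0 ∧ z = r ^ d) {U : Set (UnitPDMat d K)} (hU : IsOpen U)
    (hne : U.Nonempty) : orbitIntegral D (U.indicator 1) ≠ 0 := by
  have hcont : ContinuousOn (fun Z : Fin d → Fin d → K => act (Matrix.of Z) basePt)
      (detIn d D) := by
    unfold act
    refine continuousOn_coe_projT.comp (t := {X : Matrix (Fin d) (Fin d) K | X.PosDef}) ?_ ?_
    · have h1 : Continuous fun Z : Fin d → Fin d → K =>
        (Matrix.of Z : Matrix (Fin d) (Fin d) K) := continuous_id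
      exact ((h1.matrix_mul continuous_const).matrix_mul h1.matrix_conjTranspose).continuousOn
    · intro Z hZ
      obtain ⟨r, hr, hrd⟩ := hroot _ hZ
      refine (posDef_conj_iff ?_ _).2 basePt.2.1
      rw [hrd]
      exact (pow_ne_zero _ hr).isUnit
  have hopen := hcont.isOpen_inter_preimage (isOpen_detIn hD) hU
  have hnonempty : (detIn d D ∩ (fun Z : Fin d → Fin d → K => act (Matrix.of Z) basePt) ⁻¹'
      U).Nonempty := by
    obtain ⟨x, hx⟩ := hne
    obtain ⟨h, rfl⟩ := exists_slAct_basePt hd x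
    refine ⟨Matrix.of.symm h.1, ?_, ?_⟩
    · rw [detIn, Set.mem_ofPred_eq, Equiv.apply_symm_apply, h.2]
      exact h1
    · rw [Set.mem_preimage, Equiv.apply_symm_apply]
      have : act h.1 basePt = slAct h basePt := by
        rw [act]; exact projT_coe (slAct h basePt)
      rwa [this]
  have hpos := (hopen.measure_pos volume hnonempty).ne'
  intro h0
  apply hpos
  rw [orbitIntegral] at h0
  have h2 : ∀ Z : Fin d → Fin d → K, U.indicator (1 : UnitPDMat d K → ENNReal)
      (act (Matrix.of Z) basePt) =
      ((fun Z : Fin d → Fin d → K => act (Matrix.of Z) basePt) ⁻¹' U).indicator 1 Z :=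
    fun Z => rfl
  simp only [h2] at h0
  have hmeas : MeasurableSet ((fun Z : Fin d → Fin d → K => act (Matrix.of Z) basePt) ⁻¹' U) :=
    measurable_act_of_left basePt hU.measurableSet
  rwa [lintegral_indicator_one hmeas, Measure.restrict_apply hmeas, Set.inter_comm] at h0

theorem measurable_invTraceWeight : Measurable (invTraceWeight : UnitPDMat d K → ENNReal) := by
  have : Continuous fun x : UnitPDMat d K => RCLike.re x.1.adjugate.trace :=
    RCLike.continuous_re.comp
      (Continuous.matrix_trace (Continuous.matrix_adjugate continuous_subtype_val))
  exact (this.measurable.const_mul _).neg.exp.ennreal_ofReal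

theorem lintegral_gaussian_ne_top (n d : ℕ) (K : Type*) [RCLike K] [MeasurableSpace K]
    [BorelSpace K] : ∫⁻ Z : Fin n → Fin d → K, ENNReal.ofReal
      (Real.exp (-((Module.finrank ℝ K : ℝ) / 2 * ∑ i, ∑ j, ‖Z i j‖ ^ 2))) ≠ ⊤ := by
  obtain ⟨C, h0, ht, h⟩ := hasExpDensity_pi_scalarGaussian K n d
  intro htop
  have h1 := congrArg (fun μ => μ Set.univ) h
  simp only [Measure.smul_apply, withDensity_apply _ MeasurableSet.univ, Measure.restrict_univ,
    measure_univ, htop, smul_eq_mul, ENNReal.mul_top h0] at h1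
  exact ENNReal.one_ne_top h1

/-- For `Z = r g` the point reached is `g⁻¹(g⁻¹)*`, whose inverse has trace `‖g‖² ≥ ‖Z‖²/4`. The
factor `2k` in `invTraceWeight` therefore gives a bound by the Gaussian `exp(-(k/2)‖Z‖²)`. -/
theorem inverseOrbitIntegral_ne_top (hd : 0 < d) {D : Set K} (hD : IsOpen D)
    (hroot : ∀ z ∈ D, ∃ r : K, r ≠ 0 ∧ ‖r‖ ≤ 2 ∧ z = r ^ d) :
    inverseOrbitIntegral D (invTraceWeight (d := d) (K := K)) ≠ ⊤ := by
  refine ne_top_of_le_ne_top (lintegral_gaussian_ne_top d d K) ?_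
  refine le_trans (setLIntegral_mono' (isOpen_detIn hD).measurableSet fun Z hZ => ?_)
    (setLIntegral_le_lintegral (detIn d D) _)
  obtain ⟨r, hr, hr2, hrd⟩ := hroot _ hZ
  obtain ⟨g, hg, hg'⟩ := exists_eq_smul hr hrd
  have hgg : (slAct g⁻¹ basePt).1.adjugate = g.1ᴴ * g.1 := by
    have h1 : (g⁻¹).1.adjugate = g.1 := by
      have : (g⁻¹).1.adjugate = ((g⁻¹)⁻¹).1 := rfl
      rw [this, inv_inv]
    have h2 : (slAct g⁻¹ basePt).1 = (g⁻¹).1 * 1 * (g⁻¹).1ᴴ := rfl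
    rw [h2, Matrix.mul_one, Matrix.adjugate_mul_distrib, ← Matrix.adjugate_conjTranspose, h1]
  have hsum : RCLike.re (g.1ᴴ * g.1).trace = ∑ i, ∑ j, ‖g.1 i j‖ ^ 2 := by
    rw [Matrix.trace_mul_comm]
    simp only [Matrix.trace, Matrix.diag_apply, Matrix.mul_apply, Matrix.conjTranspose_apply,
      map_sum, RCLike.star_def, RCLike.mul_conj]
    refine Finset.sum_congr rfl fun i _ => Finset.sum_congr rfl fun j _ => ?_
    norm_cast
  have hZg : ∀ i j, Z i j = r * g.1 i j := fun i j => by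
    have := congrFun (congrFun hg i) j
    simpa using this
  rw [coact, hg', act_smul hd (pow_ne_zero _ hr), invTraceWeight, hgg, hsum]
  refine ENNReal.ofReal_le_ofReal (Real.exp_le_exp.2 (neg_le_neg ?_))
  have hle : ∑ i, ∑ j, ‖Z i j‖ ^ 2 ≤ 4 * ∑ i, ∑ j, ‖g.1 i j‖ ^ 2 := by
    simp only [Finset.mul_sum]
    refine Finset.sum_le_sum fun i _ => Finset.sum_le_sum fun j _ => ?_
    rw [hZg, norm_mul, mul_pow]
    refine mul_le_mul_of_nonneg_right ?_ (by positivity)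
    nlinarith [norm_nonneg r]
  have hk : (0 : ℝ) ≤ Module.finrank ℝ K := Nat.cast_nonneg _
  calc (Module.finrank ℝ K : ℝ) / 2 * ∑ i, ∑ j, ‖Z i j‖ ^ 2
      ≤ (Module.finrank ℝ K : ℝ) / 2 * (4 * ∑ i, ∑ j, ‖g.1 i j‖ ^ 2) := by gcongr
    _ = _ := by ring

theorem inverseOrbitIntegral_ne_zero {D : Set K} (hD : IsOpen D) (h1 : (1 : K) ∈ D)
    {φ : UnitPDMat d K → ENNReal} (hφ : Measurable φ) (hpos : ∀ x, φ x ≠ 0) :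
    inverseOrbitIntegral D φ ≠ 0 := by
  have hm : Measurable fun Z : Fin d → Fin d → K => φ (coact (Matrix.of Z) basePt) :=
    hφ.comp (measurable_coact_of_left _)
  rw [inverseOrbitIntegral, Ne, lintegral_eq_zero_iff hm]
  intro h
  rw [Filter.EventuallyEq, ae_iff] at h
  simp only [Pi.zero_apply, hpos, not_false_eq_true, Set.ofPred_true,
    Measure.restrict_apply_univ] at h
  refine ((isOpen_detIn (d := d) hD).measure_pos volume ?_).ne' h
  refine ⟨Matrix.of.symm 1, ?_⟩
  rw [detIn, Set.mem_ofPred_eq, Equiv.apply_symm_apply, Matrix.det_one]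
  exact h1

/-- Fixing the test function `invTraceWeight` in `lintegral_mul` expresses `ν` through an integral
that does not involve `ν`. -/
theorem IsInvariantVolume.exists_eq_orbitIntegral (hd : 0 < d) :
    ∃ D : Set K, (∀ U : Set (UnitPDMat d K), IsOpen U → U.Nonempty →
      orbitIntegral D (U.indicator 1) ≠ 0) ∧
      ∀ ν : Measure (UnitPDMat d K), IsInvariantVolume ν → ∃ c : ENNReal, c ≠ 0 ∧ c ≠ ⊤ ∧
        ∀ A, MeasurableSet A → ν A = c * orbitIntegral D (A.indicator 1) := by
  obtain ⟨D, hD, h1, hroot⟩ := exists_nhds_one_pow hd K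
  have hroot' : ∀ z ∈ D, ∃ r : K, r ≠ 0 ∧ z = r ^ d := fun z hz => by
    obtain ⟨r, hr, -, h⟩ := hroot z hz
    exact ⟨r, hr, h⟩
  refine ⟨D, fun U hU hne => orbitIntegral_indicator_ne_zero hd hD h1 hroot' hU hne,
    fun ν hν => ?_⟩
  set a := inverseOrbitIntegral D (invTraceWeight (d := d) (K := K))
  have ha0 : a ≠ 0 :=
    inverseOrbitIntegral_ne_zero hD h1 measurable_invTraceWeight invTraceWeight_ne_zero
  have hat : a ≠ ⊤ := inverseOrbitIntegral_ne_top hd hD hroot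
  set t := ∫⁻ x, invTraceWeight x ∂ν
  have key : ∀ A : Set (UnitPDMat d K), MeasurableSet A →
      ν A * a = t * orbitIntegral D (A.indicator 1) := fun A hA => by
    rw [← lintegral_indicator_one hA]
    exact hν.lintegral_mul hd hD hroot' (measurable_one.indicator hA) measurable_invTraceWeight
  have ht0 : t ≠ 0 := by
    rw [Ne, lintegral_eq_zero_iff measurable_invTraceWeight]
    intro h
    rw [Filter.EventuallyEq, ae_iff] at h
    simp only [Pi.zero_apply, invTraceWeight_ne_zero, not_false_eq_true, Set.ofPred_true,
      Measure.measure_univ_eq_zero] at h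
    exact hν.ne_zero h
  -- A small open set has finite `ν`-measure but nonzero orbit integral, so an infinite `t` would
  -- contradict `key`.
  have htt : t ≠ ⊤ := by
    have := hν.locallyFinite
    obtain ⟨U, hxU, hU, hUfin⟩ := Measure.exists_isOpen_measure_lt_top ν (basePt : UnitPDMat d K)
    intro htop
    have h2 := key U hU.measurableSet
    rw [htop, ENNReal.top_mul
      (orbitIntegral_indicator_ne_zero hd hD h1 hroot' hU ⟨_, hxU⟩)] at h2
    exact ENNReal.mul_ne_top hUfin.ne hat h2
  refine ⟨t / a, (ENNReal.div_pos ht0 hat).ne', (ENNReal.div_lt_top htt ha0).ne, fun A hA => ?_⟩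
  rw [← ENNReal.mul_div_right_comm, ← key A hA, ENNReal.mul_div_cancel_right ha0 hat]

theorem IsInvariantVolume.exists_eq_smul (hd : 0 < d) {ν ν' : Measure (UnitPDMat d K)}
    (hν : IsInvariantVolume ν) (hν' : IsInvariantVolume ν') :
    ∃ c : ENNReal, c ≠ 0 ∧ c ≠ ⊤ ∧ ν' = c • ν := by
  obtain ⟨D, -, h⟩ := IsInvariantVolume.exists_eq_orbitIntegral (d := d) (K := K) hd
  obtain ⟨c, h0, ht, hc⟩ := h ν hν
  obtain ⟨c', h0', ht', hc'⟩ := h ν' hν'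
  refine ⟨c' / c, (ENNReal.div_pos h0' ht).ne', (ENNReal.div_lt_top ht' h0).ne, ?_⟩
  ext A hA
  rw [Measure.smul_apply, smul_eq_mul, hc A hA, hc' A hA, ← mul_assoc, ENNReal.div_mul_cancel h0 ht]

theorem IsInvariantVolume.isOpenPosMeasure (hd : 0 < d) {ν : Measure (UnitPDMat d K)}
    (hν : IsInvariantVolume ν) : ν.IsOpenPosMeasure := by
  obtain ⟨D, hD, h⟩ := IsInvariantVolume.exists_eq_orbitIntegral (d := d) (K := K) hd
  obtain ⟨c, h0, ht, hc⟩ := h ν hν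
  refine ⟨fun U hU hne => ?_⟩
  rw [hc U hU.measurableSet]
  exact mul_ne_zero h0 (hD U hU hne)

end Uniqueness

/-! ### The law for general covariance, by translation -/

section Law

variable {d n : ℕ} {K : Type*} [RCLike K]

theorem projT_conj_of_eq_smul (hd : 0 < d) {R X : Matrix (Fin d) (Fin d) K} {r : ℝ} (hr : 0 < r)
    {g : Matrix.SpecialLinearGroup (Fin d) K} (hR : R = (r : K) • g.1) (hX : X.PosDef) :
    projT (R * X * Rᴴ) = slAct g (projT X) := by
  have h : R * X * Rᴴ = ((r ^ 2 : ℝ) : K) • (g.1 * X * g.1ᴴ) := by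
    rw [hR]
    simp only [Matrix.conjTranspose_smul, Matrix.smul_mul, Matrix.mul_smul, smul_smul]
    congr 1
    rw [RCLike.star_def, RCLike.conj_ofReal]
    push_cast
    ring
  rw [h, projT_smul hd _ (by positivity), projT_slAct hd g hX]

theorem isUnit_det_sqrtM (S : PDMat d K) : IsUnit (sqrtM S).det :=
  (Matrix.isUnit_iff_isUnit_det _).1 (sqrtM_posDef S).isUnit

theorem re_trace_slAct_inv (S : PDMat d K) {r : ℝ} (hr : 0 < r)
    {g : Matrix.SpecialLinearGroup (Fin d) K} (hR : sqrtM S = (r : K) • g.1)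
    (x : UnitPDMat d K) :
    RCLike.re (slAct g⁻¹ x).1.trace = r ^ 2 * RCLike.re (S.1⁻¹ * x.1).trace := by
  have hr' : (r : K) ≠ 0 := by exact_mod_cast hr.ne'
  have hgR : (g⁻¹).1 = (r : K) • (sqrtM S)⁻¹ := by
    have h1 : (g⁻¹).1 * g.1 = 1 := by
      have := congrArg Subtype.val (inv_mul_cancel g)
      exact this
    have h2 : (g⁻¹).1 * sqrtM S = (r : K) • 1 := by rw [hR, Matrix.mul_smul, h1]
    rw [← Matrix.mul_nonsing_inv_cancel_right _ (g⁻¹).1 (isUnit_det_sqrtM S), h2, Matrix.smul_mul,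
      Matrix.one_mul]
  have hH : (sqrtM S)⁻¹ᴴ = (sqrtM S)⁻¹ := by
    rw [Matrix.conjTranspose_nonsing_inv, (sqrtM_posDef S).1.eq]
  have hval : (slAct g⁻¹ x).1 = (g⁻¹).1 * x.1 * (g⁻¹).1ᴴ := rfl
  have hS : S.1⁻¹ = (sqrtM S)⁻¹ * (sqrtM S)⁻¹ := by
    rw [← Matrix.mul_inv_rev, sqrtM_mul_self]
  rw [hval, hgR, hS, Matrix.conjTranspose_smul, hH, Matrix.mul_smul, Matrix.smul_mul,
    Matrix.smul_mul, smul_smul, Matrix.trace_smul, Matrix.trace_mul_comm, ← Matrix.mul_assoc,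
    RCLike.star_def, RCLike.conj_ofReal, smul_eq_mul, ← RCLike.ofReal_mul, RCLike.re_ofReal_mul, sq]

theorem realDet_eq_pow (S : PDMat d K) {r : ℝ}
    {g : Matrix.SpecialLinearGroup (Fin d) K} (hR : sqrtM S = (r : K) • g.1) :
    realDet S = (r ^ 2) ^ d := by
  have h : S.1.det = ((r ^ d * r ^ d : ℝ) : K) := by
    rw [← sqrtM_mul_self, hR, Matrix.det_mul, Matrix.det_smul, g.2, Fintype.card_fin]
    push_cast
    ring
  rw [realDet, h, RCLike.ofReal_re]
  ring

theorem re_trace_inv_mul_pos (hd : 0 < d) (S : PDMat d K) (x : UnitPDMat d K) :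
    0 < RCLike.re (S.1⁻¹ * x.1).trace := by
  obtain ⟨r, g, hr, hR⟩ := exists_sqrtM_eq_smul hd S
  have h := re_trace_pos hd (slAct g⁻¹ x).2.1
  rw [re_trace_slAct_inv S hr hR] at h
  exact pos_of_mul_pos_right h (by positivity)

/-- The density of the projective Wishart law, up to a constant factor. -/
noncomputable def wishartKernel (n : ℕ) (S : PDMat d K) (x : UnitPDMat d K) : ℝ :=
  realDet S ^ (-((Module.finrank ℝ K : ℝ) * n / 2)) *
    RCLike.re (Matrix.trace (S.1⁻¹ * x.1)) ^ (-((d : ℝ) * Module.finrank ℝ K * n / 2))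

/-- Since `g⁻¹ = r S^(-1/2)`, the trace of `g⁻¹ · x` is `r² tr(S⁻¹x)`. As `det S = (r²)^d`, the
power of `r²` becomes the power of `det S`. -/
theorem wishartKernel_eq (hd : 0 < d) (n : ℕ) (S : PDMat d K) {r : ℝ} (hr : 0 < r)
    {g : Matrix.SpecialLinearGroup (Fin d) K} (hR : sqrtM S = (r : K) • g.1)
    (x : UnitPDMat d K) :
    RCLike.re (slAct g⁻¹ x).1.trace ^ (-((d : ℝ) * Module.finrank ℝ K * n / 2)) =
      wishartKernel n S x := by
  have htr := re_trace_inv_mul_pos hd S x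
  rw [wishartKernel, re_trace_slAct_inv S hr hR, realDet_eq_pow S hR,
    Real.mul_rpow (by positivity) htr.le, ← Real.rpow_natCast (r ^ 2) d,
    ← Real.rpow_mul (by positivity)]
  congr 2
  ring

theorem continuous_wishartKernel (hd : 0 < d) (n : ℕ) (S : PDMat d K) :
    Continuous (wishartKernel n S) := by
  have h : Continuous fun x : UnitPDMat d K => RCLike.re (Matrix.trace (S.1⁻¹ * x.1)) :=
    RCLike.continuous_re.comp
      (Continuous.matrix_trace (continuous_const.matrix_mul continuous_subtype_val))
  exact continuous_const.mul (h.rpow_const fun x => Or.inl (re_trace_inv_mul_pos hd S x).ne')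

variable [MeasurableSpace K] [BorelSpace K]

theorem wishart_eq_map (S : PDMat d K) (n : ℕ) :
    wishart S n = (Measure.pi fun _ : Fin n => Measure.pi fun _ : Fin d => scalarGaussian K).map
      (fun Z => sqrtM S * gram Z * (sqrtM S)ᴴ) := by
  have hm : Measurable fun z : Fin d → K => sqrtM S *ᵥ z :=
    (Continuous.matrix_mulVec continuous_const continuous_id).measurable
  have hg : Measurable (gram : (Fin n → Fin d → K) → Matrix (Fin d) (Fin d) K) :=
    continuous_gram.measurable
  have : ∀ i : Fin n, SigmaFinite ((Measure.pi fun _ : Fin d => scalarGaussian K).map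
      fun z => sqrtM S *ᵥ z) := fun i => by
    have : IsProbabilityMeasure ((Measure.pi fun _ : Fin d => scalarGaussian K).map
        fun z => sqrtM S *ᵥ z) := Measure.isProbabilityMeasure_map hm.aemeasurable
    infer_instance
  have hpi := Measure.pi_map_pi (ι := Fin n) (μ := fun _ => Measure.pi fun _ : Fin d =>
    scalarGaussian K) (f := fun _ z => sqrtM S *ᵥ z) fun _ => hm.aemeasurable
  have hw : wishart S n = (Measure.pi fun _ : Fin n => gaussianVec S).map gram := rfl
  have hm2 : Measurable fun (Z : Fin n → Fin d → K) i => sqrtM S *ᵥ Z i :=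
    measurable_pi_lambda _ fun i => hm.comp (measurable_pi_apply i)
  rw [hw]
  unfold gaussianVec
  rw [← hpi, Measure.map_map hg hm2]
  congr 1
  funext Z
  exact gram_mulVec _ Z

/-- Conjugation by `S^(1/2) = r g` is the action of `g` up to the factor `r²`, and it preserves
positive definiteness in both directions. -/
theorem projWishart_eq_map (hd : 0 < d) (S : PDMat d K) {r : ℝ} (hr : 0 < r)
    {g : Matrix.SpecialLinearGroup (Fin d) K} (hR : sqrtM S = (r : K) • g.1) (n : ℕ) :
    projWishart S n = (stdProj n d K).map (slAct g) := by
  have hproj : Measurable (proj : PDMat d K → UnitPDMat d K) := by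
    have : (proj : PDMat d K → UnitPDMat d K) = fun X => projT X.1 :=
      funext fun X => (projT_of_posDef X.2).symm
    rw [this]
    exact measurable_projT.comp measurable_subtype_coe
  have hg : Measurable (slAct g) := (continuous_slAct g).measurable
  have hcont : Continuous fun Z : Fin n → Fin d → K => sqrtM S * gram Z * (sqrtM S)ᴴ :=
    (continuous_const.matrix_mul continuous_gram).matrix_mul continuous_const
  have hemb : MeasurableEmbedding (Subtype.val : PDMat d K → Matrix (Fin d) (Fin d) K) :=
    MeasurableEmbedding.subtype_coe measurableSet_posDef
  ext A hA
  rw [projWishart, Measure.map_apply hproj hA, hemb.comap_apply, wishart_eq_map,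
    Measure.map_apply hcont.measurable (hemb.measurableSet_image.2 (hproj hA)),
    Measure.map_apply hg hA, stdProj, Measure.map_apply measurable_projT_gram (hg hA),
    Measure.restrict_apply (measurable_projT_gram (hg hA))]
  congr 1
  ext Z
  simp only [Set.mem_preimage, Set.mem_image, Subtype.exists, exists_and_right, exists_eq_right,
    Set.mem_inter_iff, Set.mem_ofPred_eq]
  constructor
  · rintro ⟨h1, h2⟩
    have hZ := (posDef_conj_iff (isUnit_det_sqrtM S) _).1 h1
    rw [← projT_of_posDef h1, projT_conj_of_eq_smul hd hr hR hZ] at h2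
    exact ⟨h2, hZ⟩
  · rintro ⟨h2, hZ⟩
    refine ⟨(posDef_conj_iff (isUnit_det_sqrtM S) _).2 hZ, ?_⟩
    rw [← projT_of_posDef, projT_conj_of_eq_smul hd hr hR hZ]
    exact h2

theorem exists_isContinuousDensity (hd : 0 < d) (hn : d ≤ n) {ν : Measure (UnitPDMat d K)}
    (hν : IsInvariantVolume ν) :
    ∃ c : ℝ, 0 < c ∧ ∀ S : PDMat d K,
      IsContinuousDensity (projWishart S n) ν fun x => c * wishartKernel n S x := by
  obtain ⟨C, h0, ht, hC⟩ := exists_stdProj_eq (K := K) hd (hd.trans_le hn)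
  obtain ⟨c, hc0, hct, hc⟩ := hν.exists_eq_smul hd (isInvariantVolume_coneMeasure hd hn)
  have hCc0 : C * c ≠ 0 := mul_ne_zero h0 hc0
  have hCct : C * c ≠ ⊤ := ENNReal.mul_ne_top ht hct
  -- `C` comes from the standard law and `c` compares the cone measure with `ν`; neither involves
  -- `S`.
  refine ⟨(C * c).toReal, ENNReal.toReal_pos hCc0 hCct, fun S => ?_⟩
  obtain ⟨r, g, hr, hR⟩ := exists_sqrtM_eq_smul hd S
  have hg : Measurable (slAct g) := (continuous_slAct g).measurable
  refine ⟨continuous_const.mul (continuous_wishartKernel hd n S), fun x => ?_, fun A hA => ?_⟩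
  · rw [← wishartKernel_eq hd n S hr hR]
    exact mul_nonneg ENNReal.toReal_nonneg
      (Real.rpow_pos_of_pos (re_trace_pos hd (slAct g⁻¹ x).2.1) _).le
  · have hmeas : Measurable fun x => ENNReal.ofReal (wishartKernel n S x) :=
      (continuous_wishartKernel hd n S).measurable.ennreal_ofReal
    have hind : Measurable (A.indicator fun x => ENNReal.ofReal (wishartKernel n S x)) :=
      hmeas.indicator hA
    rw [projWishart_eq_map hd S hr hR, Measure.map_apply hg hA, hC, hc, Measure.smul_apply,
      withDensity_smul_measure, Measure.smul_apply, smul_eq_mul, smul_eq_mul, ← mul_assoc,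
      withDensity_apply _ (hg hA)]
    simp only [ENNReal.ofReal_mul ENNReal.toReal_nonneg, ENNReal.ofReal_toReal hCct]
    rw [lintegral_const_mul' _ _ hCct]
    congr 1
    rw [← lintegral_indicator hA, ← lintegral_indicator (hg hA), ← hν.lintegral_slAct g hind]
    refine lintegral_congr fun x => ?_
    have hx : slAct g⁻¹ (slAct g x) = x := by rw [← slAct_mul, inv_mul_cancel, slAct_one]
    by_cases h : slAct g x ∈ A
    · rw [Set.indicator_of_mem h, Set.indicator_of_mem (by exact h),
        ← wishartKernel_eq hd n S hr hR, hx]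
    · rw [Set.indicator_of_notMem h, Set.indicator_of_notMem (by exact h)]

/-- Densities agree `ν`-almost everywhere, and `ν` charges every nonempty open set, so continuity
forces equality. -/
theorem IsContinuousDensity.unique (hd : 0 < d) {μ ν : Measure (UnitPDMat d K)}
    (hν : IsInvariantVolume ν) {f f' : UnitPDMat d K → ℝ}
    (hf : IsContinuousDensity μ ν f) (hf' : IsContinuousDensity μ ν f') : f = f' := by
  have := hν.sigmaFinite
  have := hν.isOpenPosMeasure hd
  have h : (fun x => ENNReal.ofReal (f x)) =ᵐ[ν] fun x => ENNReal.ofReal (f' x) := by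
    refine ae_eq_of_forall_setLIntegral_eq_of_sigmaFinite
      hf.continuous.measurable.ennreal_ofReal hf'.continuous.measurable.ennreal_ofReal ?_
    intro A hA _
    rw [← hf.measure_eq A hA, ← hf'.measure_eq A hA]
  refine (Continuous.ae_eq_iff_eq ν hf.continuous hf'.continuous).1 ?_
  filter_upwards [h] with x hx
  have := congrArg ENNReal.toReal hx
  rwa [ENNReal.toReal_ofReal (hf.nonneg x), ENNReal.toReal_ofReal (hf'.nonneg x)] at this

theorem exists_isContinuousDensity_iff (hd : 0 < d) (hn : d ≤ n) {ν : Measure (UnitPDMat d K)}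
    (hν : IsInvariantVolume ν) :
    ∃ c : ℝ, 0 < c ∧ ∀ (S : PDMat d K) (f : UnitPDMat d K → ℝ),
      IsContinuousDensity (projWishart S n) ν f ↔ ∀ x, f x = c * wishartKernel n S x := by
  obtain ⟨c, hc, h⟩ := exists_isContinuousDensity hd hn hν
  refine ⟨c, hc, fun S f => ⟨fun hf x => congrFun (hf.unique hd hν (h S)) x, fun hf => ?_⟩⟩
  rw [funext hf]
  exact h S

end Law

/-! ### Dimension two: the trace as a hyperbolic cosine of the distance -/

section Distance

variable {d : ℕ} {K : Type*} [RCLike K]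

theorem trace_cfc {H : Matrix (Fin d) (Fin d) K} (hH : H.IsHermitian) (f : ℝ → ℝ) :
    (cfc f H).trace = ∑ i, ((f (hH.eigenvalues i) : ℝ) : K) := by
  rw [hH.cfc_eq, Matrix.IsHermitian.cfc, Unitary.conjStarAlgAut_apply, Matrix.trace_mul_comm,
    ← Matrix.mul_assoc]
  simp [Matrix.trace_diagonal]

theorem hsNorm_cfc {H : Matrix (Fin d) (Fin d) K} (hH : H.IsHermitian) (f : ℝ → ℝ) :
    hsNorm (cfc f H) = √(∑ i, f (hH.eigenvalues i) ^ 2) := by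
  have hsa : (cfc f H)ᴴ = cfc f H := cfc_predicate (R := ℝ) (p := IsSelfAdjoint) f H
  have h1 : RCLike.re (cfc f H * (cfc f H)ᴴ).trace = ∑ i, ∑ j, ‖(cfc f H) i j‖ ^ 2 := by
    simp only [Matrix.trace, Matrix.diag_apply, Matrix.mul_apply, Matrix.conjTranspose_apply,
      map_sum, RCLike.star_def, RCLike.mul_conj]
    refine Finset.sum_congr rfl fun i _ => Finset.sum_congr rfl fun j _ => ?_
    norm_cast
  rw [hsNorm, ← h1, hsa, ← cfc_mul _ _ _ (cfc_continuousOn _ _) (cfc_continuousOn _ _),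
    trace_cfc hH, map_sum]
  simp only [RCLike.ofReal_re, sq]

/-- With `H = x^(-1/2) y x^(-1/2)` of eigenvalues `λ` and `1/λ`, the distance is `√2 |log λ|` and
`tr H = λ + 1/λ`. The normalization `1/√2` cancels the `√2`. -/
theorem two_mul_cosh_aiDist (x y : UnitPDMat 2 K) :
    2 * Real.cosh ((√2)⁻¹ * aiDist x y) = RCLike.re (y.1⁻¹ * x.1).trace := by
  set P : Matrix (Fin 2) (Fin 2) K := cfc (fun t : ℝ => t ^ (-(1 / 2) : ℝ)) x.1
  have hPpd : P.PosDef := cfc_posDef x.2.1 _ fun t ht => Real.rpow_pos_of_pos ht _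
  have hx : IsSelfAdjoint x.1 := x.2.1.1
  have hPP : P * P * x.1 = 1 := by
    have h1 : P * P * x.1 = cfc (fun t : ℝ => t ^ (-(1 / 2) : ℝ) * t ^ (-(1 / 2) : ℝ) * t) x.1 := by
      rw [cfc_mul _ _ _ (cfc_continuousOn _ _) (cfc_continuousOn _ _),
        cfc_mul _ _ _ (cfc_continuousOn _ _) (cfc_continuousOn _ _), cfc_id' ℝ x.1 hx]
    rw [h1, ← cfc_one ℝ x.1 hx]
    refine cfc_congr fun t ht => ?_
    have ht' := spectrum_pos x.2.1 ht
    simp only [Pi.one_apply]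
    rw [← Real.rpow_add ht', ← Real.rpow_add_one ht'.ne']
    norm_num
  have hPinv : P * P = x.1⁻¹ := (Matrix.inv_eq_left_inv hPP).symm
  set H := P * y.1 * P with hHdef
  have hH : H.PosDef := by
    have := hPpd.1.eq
    have h2 := (posDef_conj_iff ((Matrix.isUnit_iff_isUnit_det _).1 hPpd.isUnit) y.1).2 y.2.1
    rwa [this] at h2
  have hdet : H.det = 1 := by
    have := congrArg Matrix.det hPP
    rw [Matrix.det_mul, Matrix.det_mul, x.2.2, Matrix.det_one, mul_one] at this
    rw [hHdef, Matrix.det_mul, Matrix.det_mul, y.2.2, mul_one, this]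
  -- Special to two by two matrices of determinant one: the inverse is the adjugate, linear in the
  -- entries, which makes `tr(x⁻¹y)` symmetric in `x` and `y`.
  have htr : H.trace = (y.1⁻¹ * x.1).trace := by
    have h1 : H.trace = (x.1⁻¹ * y.1).trace := by
      rw [hHdef, Matrix.trace_mul_comm, ← Matrix.mul_assoc, hPinv]
    rw [h1, Matrix.inv_def, Matrix.inv_def, x.2.2, y.2.2]
    simp only [Ring.inverse_one, one_smul, Matrix.adjugate_fin_two, Matrix.trace_fin_two,
      Matrix.mul_apply, Fin.sum_univ_two, Matrix.of_apply, Matrix.cons_val', Matrix.cons_val_zero,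
      Matrix.cons_val_one, Matrix.cons_val_fin_one]
    ring
  set lam := hH.1.eigenvalues
  have hprod : lam 0 * lam 1 = 1 := by
    have := hH.1.det_eq_prod_eigenvalues
    rw [hdet, Fin.prod_univ_two] at this
    exact_mod_cast this.symm
  have hsum : RCLike.re H.trace = lam 0 + lam 1 := by
    rw [hH.1.trace_eq_sum_eigenvalues, Fin.sum_univ_two, ← RCLike.ofReal_add, RCLike.ofReal_re]
  have hl0 : 0 < lam 0 := hH.eigenvalues_pos 0
  have hl1 : lam 1 = (lam 0)⁻¹ := eq_inv_of_mul_eq_one_right hprod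
  have hdist : aiDist x y = √2 * |Real.log (lam 0)| := by
    have h1 : aiDist x y = hsNorm (cfc Real.log H) := rfl
    rw [h1, hsNorm_cfc hH.1, Fin.sum_univ_two]
    have h2 : Real.log (lam 1) = -Real.log (lam 0) := by rw [hl1, Real.log_inv]
    change √(Real.log (lam 0) ^ 2 + Real.log (lam 1) ^ 2) = _
    rw [h2, neg_sq, ← two_mul, Real.sqrt_mul (by norm_num), Real.sqrt_sq_eq_abs]
  rw [hdist, ← mul_assoc, inv_mul_cancel₀ (by positivity), one_mul, Real.cosh_abs, ← htr, hsum,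
    hl1, Real.cosh_log hl0]
  ring

theorem wishartKernel_two_eq (n : ℕ) (S : PDMat 2 K) (x : UnitPDMat 2 K) :
    wishartKernel n S x = 2 ^ (-((Module.finrank ℝ K : ℝ) * n)) *
      Real.cosh ((√2)⁻¹ * aiDist x (proj S)) ^ (-((Module.finrank ℝ K : ℝ) * n)) := by
  have hdet := realDet_pos S
  set ρ : ℝ := realDet S ^ (-(1 / ((2 : ℕ) : ℝ))) with hρ
  have hρ0 : 0 < ρ := Real.rpow_pos_of_pos hdet _
  have hproj : (proj S).1 = (ρ : K) • S.1 := rfl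
  have hinv : S.1⁻¹ = (ρ : K) • (proj S).1⁻¹ := by
    refine Matrix.inv_eq_left_inv ?_
    have h1 : (proj S).1⁻¹ * (proj S).1 = 1 :=
      Matrix.nonsing_inv_mul _ (by rw [(proj S).2.2]; exact isUnit_one)
    rw [Matrix.smul_mul, ← Matrix.mul_smul, ← hproj, h1]
  have htr : RCLike.re (S.1⁻¹ * x.1).trace =
      ρ * (2 * Real.cosh ((√2)⁻¹ * aiDist x (proj S))) := by
    rw [hinv, Matrix.smul_mul, Matrix.trace_smul, smul_eq_mul, RCLike.re_ofReal_mul,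
      two_mul_cosh_aiDist]
  have hcosh := Real.cosh_pos ((√2)⁻¹ * aiDist x (proj S))
  set q : ℝ := (Module.finrank ℝ K : ℝ) * n
  have he : -(((2 : ℕ) : ℝ) * Module.finrank ℝ K * n / 2) = -q := by push_cast; ring
  rw [wishartKernel, htr, he, Real.mul_rpow hρ0.le (by positivity),
    Real.mul_rpow (by norm_num) hcosh.le, ← mul_assoc, hρ, ← Real.rpow_mul hdet.le,
    ← Real.rpow_add hdet]
  -- The powers of `det S` cancel, so only the projected covariance remains.
  have : -(q / 2) + -(1 / ((2 : ℕ) : ℝ)) * -q = 0 := by push_cast; ring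
  rw [this, Real.rpow_zero, one_mul]

end Distance

end PWishart

theorem theorem3 (K : Type*) [RCLike K] [MeasurableSpace K] [BorelSpace K]
    (k : ℕ) (hk : k = Module.finrank ℝ K) :
    (∀ d : ℕ, 0 < d → ∃ ν : Measure (PWishart.UnitPDMat d K), PWishart.IsInvariantVolume ν) ∧
    (∀ d n : ℕ, 0 < d → d ≤ n →
      ∀ ν : Measure (PWishart.UnitPDMat d K), PWishart.IsInvariantVolume ν →
        ∃ c : ℝ, 0 < c ∧ ∀ (S : PWishart.PDMat d K) (f : PWishart.UnitPDMat d K → ℝ),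
          PWishart.IsContinuousDensity (PWishart.projWishart S n) ν f ↔
            ∀ x, f x = c * PWishart.realDet S ^ (-((k : ℝ) * n / 2)) *
              RCLike.re (Matrix.trace (S.1⁻¹ * x.1)) ^ (-((d : ℝ) * k * n / 2))) ∧
    (∃ a : ℝ, 0 < a ∧ ∀ n : ℕ, 2 < n →
      ∀ ν : Measure (PWishart.UnitPDMat 2 K), PWishart.IsInvariantVolume ν →
        ∃ c : ℝ, 0 < c ∧ ∀ (S : PWishart.PDMat 2 K) (f : PWishart.UnitPDMat 2 K → ℝ),
          PWishart.IsContinuousDensity (PWishart.projWishart S n) ν f ↔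
            ∀ x, f x = c *
              Real.cosh (a * PWishart.aiDist x (PWishart.proj S)) ^ (-((k : ℝ) * n))) := by
  subst hk
  -- Existence is witnessed by the cone measure of `d` vectors in `K^d`.
  refine ⟨fun d hd => ⟨_, PWishart.isInvariantVolume_coneMeasure hd le_rfl⟩,
    fun d n hd hn ν hν => ?_, (√2)⁻¹, by positivity, fun n hn ν hν => ?_⟩
  · simpa only [PWishart.wishartKernel, mul_assoc] using
      PWishart.exists_isContinuousDensity_iff hd hn hν
  · obtain ⟨c, hc, h⟩ := PWishart.exists_isContinuousDensity_iff two_pos hn.le hν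
    -- The power of two comes from the trace being twice the hyperbolic cosine.
    refine ⟨c * 2 ^ (-((Module.finrank ℝ K : ℝ) * n)), by positivity, fun S f => ?_⟩
    rw [h]
    simp only [PWishart.wishartKernel_two_eq, mul_assoc]
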